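/- Let $\rho_{AB}$ be a state (density operator) on $\mathbb C^{d_A}\otimes\mathbb C^{d_B}$; all logarithms are to base $2$. *Cost.* Let $|\Psi_M\rangle=M^{-1/2}\sum_{i=1}^M|i\rangle|i\rangle$ be the maximally entangled state of rank $M\ge 1$, let $F(\rho,\sigma)=\operatorname{Tr}\sqrt{\sqrt\rho\,\sigma\sqrt\rho}$, and let $\mathsf F(\rho_{AB},M)$ be the supremum of $F^2(\Lambda(\Psi_M),\rho_{AB})$ over all (finite-round) LOCC maps $\Lambda$ from $\mathbb C^M\otimes\mathbb C^M$ to $\mathbb C^{d_A}\otimes\mathbb C^{d_B}$. For $\varepsilon\ge 0$, a real $r\ge 0$ is an $\varepsilon$-achievable rate if there is an integer $M\ge1$ with $\log M\le r$ and $\mathsf F(\rho_{AB},M)\ge 1-\varepsilon$. The one-shot entanglement cost $E_C^{(1)}(\rho_{AB};\varepsilon)$ is the least $\varepsilon$-achievable rate. *Entropies.* For positive operators $\omega,\tau$ with support projectors $\Pi_\omega,\Pi_\tau$ put $S_0(\omega\|\tau)=-\log\operatorname{Tr}[\Pi_\omega\tau]$, with value $+\infty$ if $\Pi_\omega\Pi_\tau=0$,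 and put $H_0(\omega_{RA}|R)=\max_{\sigma_R}\{-S_0(\omega_{RA}\|\sigma_R\otimes 1_A)\}$, the maximum being over states $\sigma_R$. For a classical-quantum (c-q) state $\rho_{RA}=\sum_i p_i|i\rangle\langle i|_R\otimes\rho^i_A$ and $\delta\ge0$, let $H_0^\delta(\rho_{RA}|R)=\min_{\omega_{RA}} H_0(\omega_{RA}|R)$, the minimum being over all positive operators $\omega_{RA}=\sum_i|i\rangle\langle i|_R\otimes\omega_A^i$ (of any trace) with $\operatorname{Tr}|\omega_{RA}-\rho_{RA}|\le\delta$. Values in $[-\infty,\infty)$ are allowed ($H_0=-\infty$ for $\omega_{RA}=0$). *Decompositions.* Let $\mathcal D_{\rm cq}(\rho_{AB})$ be the set of all $\rho_{RAB}=\sum_i p_i|i\rangle\langle i|_R\otimes|\phi_i\rangle\langle\phi_i|_{AB}$ where $\{p_i,\phi_i\}$ is a finite ensemble of pure states with $\sum_ip_i|\phi_i\rangle\langle\phi_i|=\rho_{AB}$, and write $\rho_{RA}=\operatorname{Tr}_B\rho_{RAB}$ and $\rho_A^i=\operatorname{Tr}_B|\phi_i\rangle\langle\phi_i|$. **Theorem.**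 For every $\varepsilon\ge0$ the least $\varepsilon$-achievable rate exists, and so do the minima below, and $$\min_{\mathcal D_{\rm cq}(\rho_{AB})}H_0^{2\sqrt\varepsilon}(\rho_{RA}|R)\ \le\ E_C^{(1)}(\rho_{AB};\varepsilon),$$ and, provided $\varepsilon<2$, $$E_C^{(1)}(\rho_{AB};\varepsilon)\ \le\ \min_{\mathcal D_{\rm cq}(\rho_{AB})}H_0^{\varepsilon/2}(\rho_{RA}|R).$$ In particular, for exact dilution, $$E_C^{(1)}(\rho_{AB};0)=\min_{\mathcal D_{\rm cq}(\rho_{AB})}H_0(\rho_{RA}|R)=\min_{\{p_i,\phi_i\}}\ \max_{i:\,p_i>0}\log\operatorname{rank}\rho_A^i ,$$ where $H_0(\rho_{RA}|R)=\max_{i:\,p_i>0}\log\operatorname{rank}\rho_A^i$ for each decomposition. -/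

import Mathlib

open scoped MatrixOrder Kronecker ComplexOrder

noncomputable section

namespace OneShotDilution

/-- Operators on `ℂ^m ⊗ ℂ^n`. -/
abbrev BipMat (m n : ℕ) : Type := Matrix (Fin m × Fin n) (Fin m × Fin n) ℂ

/-- Density operators: positive semidefinite of unit trace. -/
def IsState {α : Type} [Fintype α] (ρ : Matrix α α ℂ) : Prop :=
  ρ.PosSemidef ∧ ρ.trace = 1

/-- The rank-one operator `|v⟩⟨v|`. -/
def ketbra {α : Type} (v : α → ℂ) : Matrix α α ℂ := Matrix.vecMulVec v (star v)

/-- The matrix of the orthogonal projector onto the support of a positive operator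
(for a self-adjoint operator the support is the range). -/
def suppProj {α : Type} [Fintype α] [DecidableEq α] (ρ : Matrix α α ℂ) : Matrix α α ℂ :=
  (Matrix.toEuclideanLin (𝕜 := ℂ) (m := α) (n := α)).symm
    ((LinearMap.range (Matrix.toEuclideanLin ρ)).starProjection :
      EuclideanSpace ℂ α →ₗ[ℂ] EuclideanSpace ℂ α)

/-- The trace norm `Tr √(X† X)`. -/
def traceNorm {α : Type} [Fintype α] [DecidableEq α] (X : Matrix α α ℂ) : ℝ :=
  (CFC.sqrt (X.conjTranspose * X)).trace.re

/-- The fidelity `F(ρ, σ) = Tr √(√ρ σ √ρ)` (not squared). -/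
def fidelity {α : Type} [Fintype α] [DecidableEq α] (ρ σ : Matrix α α ℂ) : ℝ :=
  (CFC.sqrt (CFC.sqrt ρ * σ * CFC.sqrt ρ)).trace.re

/-! ### Zero-Rényi entropies -/

/-- The relative Rényi entropy of order zero, `-log₂ Tr[Π_ρ σ]`, equal to `+∞` when the supports
of `ρ` and `σ` are orthogonal. -/
def relEntropyZero {α : Type} [Fintype α] [DecidableEq α] (ρ σ : Matrix α α ℂ) : EReal :=
  open Classical in
  if suppProj ρ * suppProj σ = 0 then ⊤
  else ((-Real.logb 2 (suppProj ρ * σ).trace.re : ℝ) : EReal)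

/-- `H₀(ρ_RA | R)`: the largest value of `-S₀(ρ_RA ‖ σ_R ⊗ 1_A)` over the states `σ_R`. -/
def condEntropyZero {n d : ℕ} (ρRA : BipMat n d) : EReal :=
  ⨆ (σ : Matrix (Fin n) (Fin n) ℂ) (_ : IsState σ),
    -relEntropyZero ρRA (σ ⊗ₖ (1 : Matrix (Fin d) (Fin d) ℂ))

/-- The classical-quantum operator `∑ᵢ |i⟩⟨i|_R ⊗ ωⁱ`. -/
def cqOp {n : ℕ} {α : Type} (ω : Fin n → Matrix α α ℂ) : Matrix (Fin n × α) (Fin n × α) ℂ :=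
  ∑ i, Matrix.single i i (1 : ℂ) ⊗ₖ ω i

/-- The c-q ball of radius `δ` around `ρ_RA`: positive c-q operators (of any trace) at trace
distance at most `δ`. -/
def cqBall {n d : ℕ} (δ : ℝ) (ρRA : BipMat n d) : Set (BipMat n d) :=
  {ω | ω.PosSemidef ∧ (∃ w : Fin n → Matrix (Fin d) (Fin d) ℂ, ω = cqOp w) ∧
    traceNorm (ω - ρRA) ≤ δ}

/-- The c-q-smoothed conditional zero-Rényi entropy `H₀^δ(ρ_RA | R)`. -/
def smoothCondEntropyZero {n d : ℕ} (δ : ℝ) (ρRA : BipMat n d) : EReal :=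
  ⨅ ω ∈ cqBall δ ρRA, condEntropyZero ω

/-! ### Pure-state decompositions and their c-q extensions -/

/-- `ρ = ∑ᵢ pᵢ |φᵢ⟩⟨φᵢ|` with `p` a probability vector and unit vectors `φᵢ`. -/
def IsDecomposition {dA dB n : ℕ} (ρ : BipMat dA dB) (p : Fin n → ℝ)
    (φ : Fin n → Fin dA × Fin dB → ℂ) : Prop :=
  (∀ i, 0 ≤ p i) ∧ ∑ i, p i = 1 ∧ (∀ i, star (φ i) ⬝ᵥ φ i = 1) ∧
    ∑ i, (p i : ℂ) • ketbra (φ i) = ρ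

/-- The tripartite c-q operator `∑ᵢ pᵢ |i⟩⟨i|_R ⊗ |φᵢ⟩⟨φᵢ|_AB`. -/
def cqExtension {dA dB n : ℕ} (p : Fin n → ℝ) (φ : Fin n → Fin dA × Fin dB → ℂ) :
    Matrix (Fin n × Fin dA × Fin dB) (Fin n × Fin dA × Fin dB) ℂ :=
  cqOp fun i => (p i : ℂ) • ketbra (φ i)

/-- The set of c-q extensions of `ρ_AB` whose classical register `R` has `n` basis states. -/
def cqExtensions {dA dB : ℕ} (n : ℕ) (ρ : BipMat dA dB) :
    Set (Matrix (Fin n × Fin dA × Fin dB) (Fin n × Fin dA × Fin dB) ℂ) :=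
  {τ | ∃ (p : Fin n → ℝ) (φ : Fin n → Fin dA × Fin dB → ℂ),
    IsDecomposition ρ p φ ∧ τ = cqExtension p φ}

/-- `ρ_RA = Tr_B ρ_RAB`. -/
def reduceRA {dA dB n : ℕ} (τ : Matrix (Fin n × Fin dA × Fin dB) (Fin n × Fin dA × Fin dB) ℂ) :
    BipMat n dA :=
  Matrix.of fun x y => ∑ b, τ (x.1, x.2, b) (y.1, y.2, b)

/-- `ρ_A = Tr_B ρ_AB`. -/
def reduceA {dA dB : ℕ} (ρ : BipMat dA dB) : Matrix (Fin dA) (Fin dA) ℂ :=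
  Matrix.of fun a a' => ∑ b, ρ (a, b) (a', b)

/-- The largest `log₂ rank ρ_Aⁱ` over the members of the ensemble (those with `pᵢ > 0`). -/
def maxLogRank {dA dB n : ℕ} (p : Fin n → ℝ) (φ : Fin n → Fin dA × Fin dB → ℂ) : EReal :=
  ⨆ (i : Fin n) (_ : 0 < p i), ((Real.logb 2 (reduceA (ketbra (φ i))).rank : ℝ) : EReal)

/-! ### LOCC and entanglement dilution -/

/-- The maps realised by LOCC protocols with finitely many rounds and output on
`ℂ^dA ⊗ ℂ^dB`. In a round one party applies a local measurement with Kraus operators `K x`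
(whose output space may depend on the outcome), announces the outcome `x`, and the rest
`Λ x` of the protocol may depend on `x`. An outcome kept secret or forgotten is one on which the
rest does not depend; attaching an ancilla and discarding a subsystem are special cases. -/
inductive IsLOCC (dA dB : ℕ) : (m n : ℕ) → (BipMat m n → BipMat dA dB) → Prop
  | done : IsLOCC dA dB dA dB fun X => X
  | alice {m n : ℕ} (q : ℕ) (m' : Fin q → ℕ) (K : (x : Fin q) → Matrix (Fin (m' x)) (Fin m) ℂ)
      (hK : ∑ x, (K x).conjTranspose * K x = 1)
      (Λ : (x : Fin q) → BipMat (m' x) n → BipMat dA dB)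
      (hΛ : ∀ x, IsLOCC dA dB (m' x) n (Λ x)) :
      IsLOCC dA dB m n fun X => ∑ x, Λ x ((K x ⊗ₖ (1 : Matrix (Fin n) (Fin n) ℂ)) * X *
        (K x ⊗ₖ (1 : Matrix (Fin n) (Fin n) ℂ)).conjTranspose)
  | bob {m n : ℕ} (q : ℕ) (n' : Fin q → ℕ) (K : (x : Fin q) → Matrix (Fin (n' x)) (Fin n) ℂ)
      (hK : ∑ x, (K x).conjTranspose * K x = 1)
      (Λ : (x : Fin q) → BipMat m (n' x) → BipMat dA dB)
      (hΛ : ∀ x, IsLOCC dA dB m (n' x) (Λ x)) :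
      IsLOCC dA dB m n fun X => ∑ x, Λ x (((1 : Matrix (Fin m) (Fin m) ℂ) ⊗ₖ K x) * X *
        ((1 : Matrix (Fin m) (Fin m) ℂ) ⊗ₖ K x).conjTranspose)

/-- The maximally entangled state of rank `M`, the projector onto `M^{-1/2} ∑ᵢ |i⟩|i⟩`. -/
def maxEntangled (M : ℕ) : BipMat M M :=
  ketbra fun x => if x.1 = x.2 then (((Real.sqrt M)⁻¹ : ℝ) : ℂ) else 0

/-- The optimal fidelity of dilution: the best `F²(Λ(Ψ_M), ρ_AB)` over LOCC maps `Λ`. -/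
def dilutionFidelity {dA dB : ℕ} (ρ : BipMat dA dB) (M : ℕ) : ℝ :=
  sSup {f : ℝ | ∃ Λ : BipMat M M → BipMat dA dB, IsLOCC dA dB M M Λ ∧
    f = fidelity (Λ (maxEntangled M)) ρ ^ 2}

/-- `R` is an `ε`-achievable rate for dilution. -/
def IsAchievableRate {dA dB : ℕ} (ρ : BipMat dA dB) (ε R : ℝ) : Prop :=
  0 ≤ R ∧ ∃ M : ℕ, 1 ≤ M ∧ Real.logb 2 M ≤ R ∧ 1 - ε ≤ dilutionFidelity ρ M

/-- The one-shot entanglement cost, the least `ε`-achievable rate. -/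
def oneShotCost {dA dB : ℕ} (ρ : BipMat dA dB) (ε : ℝ) : ℝ :=
  sInf {R : ℝ | IsAchievableRate ρ ε R}

/-- The values of `H₀^δ(ρ_RA | R)` over all c-q extensions of `ρ_AB`. -/
def smoothEntropyValues {dA dB : ℕ} (ρ : BipMat dA dB) (δ : ℝ) : Set EReal :=
  {x | ∃ n : ℕ, ∃ τ ∈ cqExtensions n ρ, x = smoothCondEntropyZero δ (reduceRA τ)}

end OneShotDilution

end

/-! On c-q operators the conditional zero-entropy is the logarithm of the largest block rank
(`condEntropyZero_cqOp`), so the theorem compares LOCC dilution with ensembles of bounded Schmidt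
rank. All entropies involved are logarithms of integers between 0 and `dA`, with value `⊥` at 0;
hence the minima exist.

Lower bound. LOCC turns the maximally entangled state of rank `M` into a mixture of vectors `u k` of
Schmidt rank at most `M` (`IsLOCC.exists_ensemble`). Uhlmann's theorem pairs these with vectors `x
k` whose mixture lies below `ρ`. Compressing each `x k` on Bob's side to the support of `(x k)ᴴ u k`
preserves its overlap with `u k` and leaves a reduced operator of rank at most `M`, dominated by
that of `x k`. By Cauchy–Schwarz the total trace lost is at most `1 - F²`
(`exists_decomposition_near`). For `ε > 0` the radius `2√ε` leaves room for the supremum over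
protocols not being attained, and from `2√ε ≥ 1` on the zero operator is in the ball. For `ε = 0`
there is no room, and compactness of the convex hull of bounded-rank projectors is used instead
(`exists_decomposition_rank_le`).

Upper bound. Given a c-q operator `w` within `δ` of `ρ_RA` and with blocks of rank at most `M`, each
`φ i` is projected onto the support of `w i` and normalised. The resulting vectors can be prepared
exactly from rank `M` (`exists_isLOCC_prepare_mixture`), and their mixture has fidelity at least `1
- δ` (`exists_isLOCC_fidelity_ge`). Squaring gives `1 - 2δ`, which is `1 - ε` at `δ = ε / 2`. -/

noncomputable section

namespace OneShotDilution

open Matrix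

/-! ### Operator order, polar decomposition and Uhlmann's theorem -/

section Basics

variable {α ι : Type} [Fintype α]

lemma trace_re_mono {A B : Matrix α α ℂ} (h : A ≤ B) : A.trace.re ≤ B.trace.re := by
  have := (Complex.le_def.1 (Matrix.le_iff.1 h).trace_nonneg).1
  rw [trace_sub] at this
  simpa using this

lemma conj_mono [Fintype ι] {A B : Matrix α α ℂ} (h : A ≤ B) (K : Matrix ι α ℂ) :
    K * A * Kᴴ ≤ K * B * Kᴴ := by
  rw [Matrix.le_iff] at *
  have := h.mul_mul_conjTranspose_same K
  rwa [Matrix.mul_sub, Matrix.sub_mul] at this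

lemma conj_mono' [Fintype ι] {A B : Matrix α α ℂ} (h : A ≤ B) (K : Matrix α ι ℂ) :
    Kᴴ * A * K ≤ Kᴴ * B * K := by
  simpa using conj_mono h Kᴴ

variable [DecidableEq α]

lemma sqrt_isHermitian (A : Matrix α α ℂ) : (CFC.sqrt A)ᴴ = CFC.sqrt A :=
  (Matrix.nonneg_iff_posSemidef.1 (CFC.sqrt_nonneg A)).isHermitian

lemma sqrt_posSemidef (A : Matrix α α ℂ) : (CFC.sqrt A).PosSemidef :=
  Matrix.nonneg_iff_posSemidef.1 (CFC.sqrt_nonneg A)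

lemma sqrt_mul_sqrt {A : Matrix α α ℂ} (hA : A.PosSemidef) : CFC.sqrt A * CFC.sqrt A = A :=
  CFC.sqrt_mul_sqrt_self A hA.nonneg

/-- A positive operator has a Hermitian pseudo-inverse commuting with it. -/
lemma exists_pseudoinverse {T : Matrix α α ℂ} (hT : T.PosSemidef) :
    ∃ S : Matrix α α ℂ, Sᴴ = S ∧ S * T = T * S ∧ T * S * T = T ∧ S * T * S = S := by
  have hs : IsSelfAdjoint T := hT.isHermitian
  -- Every function is continuous on a finite spectrum. With `0⁻¹ = 0`, the function `x⁻¹` inverts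
  -- `T` on its support and vanishes on its kernel.
  have hfin : (spectrum ℝ T).Finite := Matrix.finite_real_spectrum
  have hc : ContinuousOn (fun x : ℝ => x⁻¹) (spectrum ℝ T) := hfin.continuousOn _
  have hi : ContinuousOn (fun x : ℝ => x) (spectrum ℝ T) := continuousOn_id
  have h1 : cfc (fun x : ℝ => x) T = T := cfc_id' ℝ T
  have hST : cfc (fun x : ℝ => x⁻¹) T * T = cfc (fun x : ℝ => x⁻¹ * x) T := by
    rw [cfc_mul (fun x : ℝ => x⁻¹) (fun x => x) T hc hi, h1]
  have hTS : T * cfc (fun x : ℝ => x⁻¹) T = cfc (fun x : ℝ => x * x⁻¹) T := by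
    rw [cfc_mul (fun x : ℝ => x) (fun x => x⁻¹) T hi hc, h1]
  refine ⟨cfc (fun x : ℝ => x⁻¹) T, ?_, ?_, ?_, ?_⟩
  · exact (cfc_predicate (fun x : ℝ => x⁻¹) T : IsSelfAdjoint _)
  · rw [hST, hTS]
    simp only [mul_comm]
  · have h : cfc (fun x : ℝ => x * x⁻¹) T * cfc (fun x : ℝ => x) T = cfc (fun x : ℝ => x) T := by
      rw [← cfc_mul _ _ T (hfin.continuousOn _) hi]
      simp only [mul_inv_mul_cancel]
    rwa [h1, ← hTS] at h
  · have h : cfc (fun x : ℝ => x⁻¹ * x) T * cfc (fun x : ℝ => x⁻¹) T =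
        cfc (fun x : ℝ => x⁻¹) T := by
      rw [← cfc_mul _ _ T (hfin.continuousOn _) hc]
      congr 1
      ext x
      by_cases hx : x = 0 <;> simp [hx]
    rwa [← hST] at h

variable [Fintype ι]

/-- Polar decomposition of a rectangular matrix. -/
lemma exists_polar (Y : Matrix α ι ℂ) :
    ∃ W : Matrix α ι ℂ, CFC.sqrt (Y * Yᴴ) * W = Y ∧ Y * Wᴴ = CFC.sqrt (Y * Yᴴ) ∧
      W * Wᴴ ≤ 1 := by
  have hYY := posSemidef_self_mul_conjTranspose Y
  set T := CFC.sqrt (Y * Yᴴ) with hTdef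
  have hT : T.PosSemidef := sqrt_posSemidef _
  have hTT : T * T = Y * Yᴴ := sqrt_mul_sqrt hYY
  have hTh : Tᴴ = T := hT.isHermitian
  obtain ⟨S, hSh, hc, h1, h2⟩ := exists_pseudoinverse hT
  have hTS : T * S * Y = Y := by
    -- `T * S` fixes the range of `T`, hence that of `Y`: the Gram matrix of `(1 - T * S) * Y`
    -- contains the factor `(1 - T * S) * T = 0`.
    have h0 : (1 - T * S) * Y * ((1 - T * S) * Y)ᴴ = 0 := by
      rw [conjTranspose_mul, ← Matrix.mul_assoc, Matrix.mul_assoc _ Y, ← hTT,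
        ← Matrix.mul_assoc, Matrix.sub_mul 1, Matrix.one_mul, h1, sub_self]
      simp
    have := Matrix.self_mul_conjTranspose_eq_zero.1 h0
    rw [Matrix.sub_mul, Matrix.one_mul, sub_eq_zero] at this
    exact this.symm
  refine ⟨S * Y, ?_, ?_, ?_⟩
  · rw [← Matrix.mul_assoc, hTS]
  · rw [conjTranspose_mul, hSh, ← Matrix.mul_assoc, ← hTT, Matrix.mul_assoc, ← hc,
      ← Matrix.mul_assoc, h1]
  · have e : S * Y * (S * Y)ᴴ = T * S := by
      rw [conjTranspose_mul, hSh, Matrix.mul_assoc, ← Matrix.mul_assoc Y, ← hTT, Matrix.mul_assoc T,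
        ← hc, ← Matrix.mul_assoc T, h1, hc]
    rw [e, Matrix.le_iff]
    have e2 : (1 - T * S) = (1 - T * S) * (1 - T * S)ᴴ := by
      rw [conjTranspose_sub, conjTranspose_mul, hSh, hTh, hc, conjTranspose_one, Matrix.mul_sub,
        Matrix.sub_mul, Matrix.sub_mul, Matrix.one_mul, Matrix.mul_one, Matrix.one_mul,
        ← Matrix.mul_assoc, h1]
      simp
    rw [e2]
    exact posSemidef_self_mul_conjTranspose _

/-- Writing `P = Wᴴ * W`, the identity `1 - P = (1 - P)² + Wᴴ * (1 - W * Wᴴ) * W` is a sum of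
positive terms. -/
lemma conjTranspose_mul_self_le_one_of_le {W : Matrix α ι ℂ} [DecidableEq ι] (h : W * Wᴴ ≤ 1) :
    Wᴴ * W ≤ 1 := by
  rw [Matrix.le_iff] at *
  have e : 1 - Wᴴ * W = (1 - Wᴴ * W) * (1 - Wᴴ * W)ᴴ + Wᴴ * (1 - W * Wᴴ) * W := by
    simp only [conjTranspose_sub, conjTranspose_mul, conjTranspose_one,
      conjTranspose_conjTranspose, Matrix.mul_sub, Matrix.sub_mul, Matrix.mul_one, Matrix.one_mul,
      Matrix.mul_assoc]
    abel
  rw [e]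
  exact (posSemidef_self_mul_conjTranspose _).add (h.conjTranspose_mul_mul_same W)

/-- Expanding `Tr (W - Z)ᴴ T (W - Z) ≥ 0` bounds the cross term by the mean of `Tr Wᴴ T W` and `Tr
Zᴴ T Z`, and each of these is at most `Tr T` for contractions. -/
lemma re_trace_mul_le {T : Matrix α α ℂ} (hT : T.PosSemidef) {W Z : Matrix α ι ℂ}
    (hW : W * Wᴴ ≤ 1) (hZ : Z * Zᴴ ≤ 1) : (Wᴴ * (T * Z)).trace.re ≤ T.trace.re := by
  have hb : ∀ W : Matrix α ι ℂ, W * Wᴴ ≤ 1 → (Wᴴ * T * W).trace.re ≤ T.trace.re := by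
    intro W hW
    have h := trace_re_mono (conj_mono hW (CFC.sqrt T))
    rw [sqrt_isHermitian, Matrix.mul_one, sqrt_mul_sqrt hT, trace_mul_comm, ← Matrix.mul_assoc,
      sqrt_mul_sqrt hT, ← Matrix.mul_assoc, trace_mul_comm, ← Matrix.mul_assoc] at h
    exact h
  have h0 := (Complex.le_def.1 (hT.conjTranspose_mul_mul_same (W - Z)).trace_nonneg).1
  have hcross : (Zᴴ * T * W).trace.re = (Wᴴ * T * Z).trace.re := by
    have : (Zᴴ * T * W) = (Wᴴ * T * Z)ᴴ := by
      rw [conjTranspose_mul, conjTranspose_mul, hT.isHermitian.eq, conjTranspose_conjTranspose,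
        Matrix.mul_assoc]
    rw [this, trace_conjTranspose]; simp
  rw [conjTranspose_sub, Matrix.mul_sub, Matrix.sub_mul, Matrix.sub_mul, Matrix.sub_mul] at h0
  simp only [trace_sub, Complex.sub_re, Complex.zero_re] at h0
  rw [← Matrix.mul_assoc]
  linarith [hb W hW, hb Z hZ]

/-- One half of Uhlmann's theorem: overlaps of purifications are bounded by the fidelity. -/
lemma re_trace_le_fidelity (V X : Matrix α ι ℂ) :
    (Vᴴ * X).trace.re ≤ fidelity (V * Vᴴ) (X * Xᴴ) := by
  obtain ⟨W, hW, -, hW1⟩ := exists_polar V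
  set s := CFC.sqrt (V * Vᴴ)
  have hs : sᴴ = s := sqrt_isHermitian _
  obtain ⟨Z, hZ, -, hZ1⟩ := exists_polar (s * X)
  have e : s * X * (s * X)ᴴ = s * (X * Xᴴ) * s := by
    rw [conjTranspose_mul, hs]; simp only [Matrix.mul_assoc]
  have e2 : Vᴴ * X = Wᴴ * (CFC.sqrt (s * X * (s * X)ᴴ) * Z) := by
    rw [hZ, ← Matrix.mul_assoc]
    conv_lhs => rw [← hW, conjTranspose_mul, hs]
  rw [e2, fidelity, ← e]
  exact re_trace_mul_le (sqrt_posSemidef _) hW1 hZ1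

/-- The other half of Uhlmann's theorem: the fidelity is attained by a subnormalised ensemble. -/
lemma exists_re_trace_eq_fidelity (V : Matrix α ι ℂ) {ρ : Matrix α α ℂ} (hρ : ρ.PosSemidef) :
    ∃ X : Matrix α ι ℂ, X * Xᴴ ≤ ρ ∧ (Vᴴ * X).trace.re = fidelity (V * Vᴴ) ρ := by
  obtain ⟨W, hW, hW', hW1⟩ := exists_polar V
  set s := CFC.sqrt (V * Vᴴ)
  have hs : sᴴ = s := sqrt_isHermitian _
  set r := CFC.sqrt ρ
  have hr : rᴴ = r := sqrt_isHermitian _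
  have hrr : r * r = ρ := sqrt_mul_sqrt hρ
  obtain ⟨Z, hZ, hZ', hZ1⟩ := exists_polar (s * r)
  have e : s * r * (s * r)ᴴ = s * ρ * s := by
    rw [conjTranspose_mul, hs, hr, ← hrr]; simp only [Matrix.mul_assoc]
  rw [e] at hZ hZ'
  set T := CFC.sqrt (s * ρ * s) with hT
  have hWs : W * Wᴴ * s = s := by
    have : s * (W * Wᴴ) = s := by rw [← Matrix.mul_assoc, hW, hW']
    have := congrArg conjTranspose this
    simpa [hs, Matrix.mul_assoc] using this
  -- From `V = s * W` and `s * r = T * Z`, this choice gives `Vᴴ * X = Wᴴ * T * W`. Its trace is `Tr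
  -- T`, since `W * Wᴴ` is the identity on the range of `s`, which contains that of `T`. As `W` and
  -- `Z` are contractions, `X * Xᴴ ≤ r * r = ρ`.
  refine ⟨r * (Zᴴ * W), ?_, ?_⟩
  · have h1 : Zᴴ * W * (Zᴴ * W)ᴴ ≤ 1 := by
      have h := conj_mono hW1 Zᴴ
      rw [conjTranspose_conjTranspose, Matrix.mul_one] at h
      refine le_trans (le_of_eq ?_) (h.trans (conjTranspose_mul_self_le_one_of_le hZ1))
      simp [Matrix.mul_assoc]
    have h := conj_mono h1 r
    rw [Matrix.mul_one, hr, hrr] at h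
    refine le_trans (le_of_eq ?_) h
    simp [Matrix.mul_assoc, hr]
  · have : Vᴴ * (r * (Zᴴ * W)) = Wᴴ * (T * W) := by
      rw [← hZ', ← hW]
      simp only [conjTranspose_mul, hs, Matrix.mul_assoc]
    rw [this, trace_mul_comm, fidelity, ← hT, ← hZ']
    congr 2
    calc s * r * Zᴴ * W * Wᴴ = T * (W * Wᴴ) := by rw [← hZ', Matrix.mul_assoc _ W]
      _ = (W * Wᴴ * T)ᴴ := by
        rw [conjTranspose_mul, conjTranspose_mul, conjTranspose_conjTranspose, hT,
          sqrt_isHermitian]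
      _ = T := by
        rw [← hZ', ← Matrix.mul_assoc, ← Matrix.mul_assoc, hWs, hZ', hT, sqrt_isHermitian]
      _ = _ := hZ'.symm

lemma fidelity_nonneg (σ ρ : Matrix α α ℂ) : 0 ≤ fidelity σ ρ :=
  (Complex.le_def.1 (sqrt_posSemidef _).trace_nonneg).1

end Basics

/-! ### Support projectors -/

section SupportProjection

variable {α : Type} [Fintype α] [DecidableEq α]

lemma toEuclideanLin_eq_toLin_basisFun :
    (toEuclideanLin : Matrix α α ℂ ≃ₗ[ℂ] _) =
      toLin (PiLp.basisFun 2 ℂ α) (PiLp.basisFun 2 ℂ α) :=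
  toLpLin_eq_toLin 2 2

lemma toEuclideanLin_suppProj (A : Matrix α α ℂ) :
    toEuclideanLin (suppProj A) =
      ((LinearMap.range (toEuclideanLin A)).starProjection :
        EuclideanSpace ℂ α →ₗ[ℂ] EuclideanSpace ℂ α) := by
  simp [suppProj]

lemma suppProj_isHermitian (A : Matrix α α ℂ) : (suppProj A)ᴴ = suppProj A := by
  have : (suppProj A).IsHermitian := by
    rw [← isSymmetric_toEuclideanLin_iff, toEuclideanLin_suppProj]
    exact Submodule.starProjection_isSymmetric _
  exact this

lemma suppProj_mul_self (A : Matrix α α ℂ) : suppProj A * A = A := by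
  apply (toEuclideanLin (𝕜 := ℂ)).injective
  rw [toLpLin_mul_same, toEuclideanLin_suppProj]
  ext1 v
  exact Submodule.starProjection_eq_self_iff (K := LinearMap.range (toEuclideanLin A)).2
    (LinearMap.mem_range_self _ v)

/-- Each column of the projector lies in the range of `A`. Together with `suppProj_mul_self`, this
factorisation replaces all geometric arguments about supports by algebra. -/
lemma exists_suppProj_eq_mul (A : Matrix α α ℂ) : ∃ S : Matrix α α ℂ, suppProj A = A * S := by
  have h : ∀ v : EuclideanSpace ℂ α, ∃ w, toEuclideanLin A w = toEuclideanLin (suppProj A) v := by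
    intro v
    rw [toEuclideanLin_suppProj]
    exact LinearMap.mem_range.1
      (Submodule.starProjection_apply_mem (LinearMap.range (toEuclideanLin A)) v)
  choose w hw using fun j => h (EuclideanSpace.single j 1)
  refine ⟨of fun i j => w j i, ?_⟩
  ext i j
  have := congrArg (fun u : EuclideanSpace ℂ α => u i) (hw j)
  simp only [toLpLin_apply, PiLp.ofLp_single, mulVec_single_one] at this
  exact this.symm

lemma suppProj_mul_suppProj (A : Matrix α α ℂ) : suppProj A * suppProj A = suppProj A := by
  obtain ⟨S, hS⟩ := exists_suppProj_eq_mul A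
  conv_lhs => rw [hS, ← Matrix.mul_assoc, ← hS, suppProj_mul_self]
  exact hS.symm

lemma trace_suppProj (A : Matrix α α ℂ) : (suppProj A).trace = A.rank := by
  have h1 : (suppProj A).trace = LinearMap.trace ℂ _ (toEuclideanLin (suppProj A)) := by
    rw [toEuclideanLin_eq_toLin_basisFun]
    exact (trace_toLin_eq _ _).symm
  have h2 : LinearMap.IsProj (LinearMap.range (toEuclideanLin A))
      (toEuclideanLin (suppProj A)) := by
    rw [toEuclideanLin_suppProj]
    exact ⟨fun x => Submodule.starProjection_apply_mem _ x,
      fun x hx => Submodule.starProjection_eq_self_iff.2 hx⟩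
  rw [h1, h2.trace, toEuclideanLin_eq_toLin_basisFun, ← rank_eq_finrank_range_toLin]

lemma rank_suppProj (A : Matrix α α ℂ) : (suppProj A).rank = A.rank := by
  obtain ⟨S, hS⟩ := exists_suppProj_eq_mul A
  refine le_antisymm (by rw [hS]; exact rank_mul_le_left _ _) ?_
  conv_lhs => rw [← suppProj_mul_self A]
  exact rank_mul_le_left _ _

/-- The support projector is determined by its algebraic properties. -/
lemma eq_suppProj {A P S : Matrix α α ℂ} (hP : Pᴴ = P) (hA : P * A = A) (hS : P = A * S) :
    P = suppProj A := by
  obtain ⟨S', hS'⟩ := exists_suppProj_eq_mul A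
  have h1 : suppProj A * P = P := by
    conv_lhs => rw [hS, ← Matrix.mul_assoc, suppProj_mul_self]
    exact hS.symm
  have h2 : P * suppProj A = suppProj A := by
    conv_lhs => rw [hS', ← Matrix.mul_assoc, hA]
    exact hS'.symm
  have := congrArg conjTranspose h1
  rw [conjTranspose_mul, hP, suppProj_isHermitian, h2] at this
  exact this.symm

lemma suppProj_le_one (A : Matrix α α ℂ) : suppProj A ≤ 1 := by
  have : 1 - suppProj A = (1 - suppProj A) * (1 - suppProj A)ᴴ := by
    rw [conjTranspose_sub, conjTranspose_one, suppProj_isHermitian, Matrix.mul_sub, Matrix.sub_mul,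
      Matrix.sub_mul, suppProj_mul_suppProj]
    simp
  rw [le_iff, this]
  exact posSemidef_self_mul_conjTranspose _

lemma suppProj_posSemidef (A : Matrix α α ℂ) : (suppProj A).PosSemidef := by
  have : suppProj A = suppProj A * (suppProj A)ᴴ := by
    rw [suppProj_isHermitian, suppProj_mul_suppProj]
  rw [this]
  exact posSemidef_self_mul_conjTranspose _

end SupportProjection

/-! ### Block calculus of classical-quantum operators -/

section ClassicalQuantum

variable {n : ℕ} {α : Type}

lemma cqOp_apply (w : Fin n → Matrix α α ℂ) (x y : Fin n × α) :
    cqOp w x y = if x.1 = y.1 then w x.1 x.2 y.2 else 0 := by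
  obtain ⟨i, a⟩ := x
  obtain ⟨j, b⟩ := y
  simp only [cqOp, Matrix.sum_apply, kroneckerMap_apply, single_apply]
  rw [Finset.sum_eq_single i]
  · by_cases h : i = j <;> simp [h]
  · intro k _ hk
    simp [hk]
  · simp

lemma cqOp_conjTranspose (w : Fin n → Matrix α α ℂ) : (cqOp w)ᴴ = cqOp fun i => (w i)ᴴ := by
  ext x y
  simp only [conjTranspose_apply, cqOp_apply]
  by_cases h : x.1 = y.1
  · simp [h]
  · simp [h, Ne.symm h]

lemma cqOp_sub (w v : Fin n → Matrix α α ℂ) : cqOp w - cqOp v = cqOp fun i => w i - v i := by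
  ext x y
  simp only [Matrix.sub_apply, cqOp_apply]
  split_ifs <;> simp

lemma posSemidef_of_cqOp {w : Fin n → Matrix α α ℂ} (hw : (cqOp w).PosSemidef) (i : Fin n) :
    (w i).PosSemidef := by
  have := hw.submatrix (fun a => (i, a))
  convert this using 1
  ext a b
  simp [cqOp_apply]

variable [Fintype α]

lemma cqOp_mul (w v : Fin n → Matrix α α ℂ) : cqOp w * cqOp v = cqOp fun i => w i * v i := by
  ext x y
  simp only [mul_apply, cqOp_apply, Fintype.sum_prod_type, ite_mul, mul_ite, zero_mul, mul_zero]
  rw [Finset.sum_eq_single x.1]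
  · by_cases h : x.1 = y.1 <;> simp [h]
  · intro k _ hk
    simp [Ne.symm hk]
  · simp

lemma trace_cqOp (w : Fin n → Matrix α α ℂ) : (cqOp w).trace = ∑ i, (w i).trace := by
  simp [trace, cqOp_apply, Fintype.sum_prod_type]

variable [DecidableEq α]

lemma cqOp_posSemidef {w : Fin n → Matrix α α ℂ} (hw : ∀ i, (w i).PosSemidef) :
    (cqOp w).PosSemidef := by
  have : cqOp w = (cqOp fun i => CFC.sqrt (w i)) * (cqOp fun i => CFC.sqrt (w i))ᴴ := by
    rw [cqOp_conjTranspose, cqOp_mul]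
    congr 1
    funext i
    rw [sqrt_isHermitian, sqrt_mul_sqrt (hw i)]
  rw [this]
  exact posSemidef_self_mul_conjTranspose _

lemma suppProj_cqOp (w : Fin n → Matrix α α ℂ) :
    suppProj (cqOp w) = cqOp fun i => suppProj (w i) := by
  choose S hS using fun i => exists_suppProj_eq_mul (w i)
  refine (eq_suppProj (S := cqOp S) ?_ ?_ ?_).symm
  · rw [cqOp_conjTranspose]
    simp only [suppProj_isHermitian]
  · rw [cqOp_mul]
    simp only [suppProj_mul_self]
  · rw [cqOp_mul]
    simp only [← hS]

lemma trace_cqOp_mul_kronecker_one (P : Fin n → Matrix α α ℂ) (σ : Matrix (Fin n) (Fin n) ℂ) :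
    (cqOp P * (σ ⊗ₖ (1 : Matrix α α ℂ))).trace = ∑ i, σ i i * (P i).trace := by
  simp only [trace, diag, mul_apply, cqOp_apply, Fintype.sum_prod_type, kroneckerMap_apply,
    ite_mul, zero_mul]
  refine Finset.sum_congr rfl fun i _ => ?_
  rw [Finset.mul_sum]
  refine Finset.sum_congr rfl fun a _ => ?_
  rw [Finset.sum_eq_single i]
  · rw [Finset.sum_eq_single a]
    · simp [mul_comm]
    · intro b _ hb
      simp [one_apply_ne hb]
    · simp
  · intro k _ hk
    simp [Ne.symm hk]
  · simp

end ClassicalQuantum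

/-! ### Zero-entropies as logarithms of ranks -/

section Entropy

/-- The binary logarithm with values in the extended reals, `-∞` at `0`. -/
def logTwo (x : ℝ) : EReal := if x = 0 then ⊥ else ((Real.logb 2 x : ℝ) : EReal)

lemma logTwo_zero : logTwo 0 = ⊥ := by simp [logTwo]

lemma logTwo_of_ne {x : ℝ} (hx : x ≠ 0) : logTwo x = ((Real.logb 2 x : ℝ) : EReal) := by
  simp [logTwo, hx]

lemma logTwo_mono {x y : ℝ} (hx : 0 ≤ x) (h : x ≤ y) : logTwo x ≤ logTwo y := by
  rcases hx.eq_or_lt with rfl | hx'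
  · simp [logTwo_zero]
  · rw [logTwo_of_ne hx'.ne', logTwo_of_ne (hx'.trans_le h).ne', EReal.coe_le_coe_iff]
    exact Real.logb_le_logb_of_le (by norm_num) hx' h

lemma le_of_logTwo_le {x y : ℝ} (hy : 0 ≤ y) (h : logTwo x ≤ logTwo y) : x ≤ y := by
  by_contra! hlt
  have hx : 0 < x := hy.trans_lt hlt
  rw [logTwo_of_ne hx.ne'] at h
  rcases hy.eq_or_lt with rfl | hy'
  · simp [logTwo_zero] at h
  · rw [logTwo_of_ne hy'.ne', EReal.coe_le_coe_iff] at h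
    exact absurd h (not_le.2 (Real.logb_lt_logb (by norm_num) hy' hlt))

/-- The trace of `P * τ`, with `P = suppProj A`, is the squared Hilbert–Schmidt norm of `P * √τ`.
Thus the case `+∞` of the relative entropy is exactly the case of a vanishing argument of the
logarithm, so that `logTwo` covers both cases. -/
lemma trace_suppProj_mul_eq_zero_iff {α : Type} [Fintype α] [DecidableEq α] (A : Matrix α α ℂ)
    {τ : Matrix α α ℂ} (hτ : τ.PosSemidef) :
    (suppProj A * τ).trace.re = 0 ↔ suppProj A * suppProj τ = 0 := by
  obtain ⟨S, hS⟩ := exists_suppProj_eq_mul τ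
  have hPP := suppProj_mul_suppProj A
  have hPh := suppProj_isHermitian A
  set P := suppProj A
  have e : (P * τ).trace = (P * τ * Pᴴ).trace := by
    rw [hPh, trace_mul_comm (P * τ), ← Matrix.mul_assoc, hPP]
  constructor
  · intro h
    have h0 := hτ.mul_mul_conjTranspose_same P
    have htr : (P * τ * Pᴴ).trace = 0 := by
      have hn := Complex.le_def.1 h0.trace_nonneg
      rw [← e] at hn ⊢
      exact Complex.ext h hn.2.symm
    have hs : P * CFC.sqrt τ = 0 := by
      rw [← trace_mul_conjTranspose_self_eq_zero_iff, conjTranspose_mul, sqrt_isHermitian,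
        ← Matrix.mul_assoc, Matrix.mul_assoc P, sqrt_mul_sqrt hτ, htr]
    rw [hS, ← Matrix.mul_assoc, ← sqrt_mul_sqrt hτ, ← Matrix.mul_assoc, hs]
    simp
  · intro h
    have : P * τ = 0 := by
      rw [← suppProj_mul_self τ, ← Matrix.mul_assoc, h, Matrix.zero_mul]
    simp [this]

lemma neg_relEntropyZero {α : Type} [Fintype α] [DecidableEq α] (A : Matrix α α ℂ)
    {τ : Matrix α α ℂ} (hτ : τ.PosSemidef) :
    -relEntropyZero A τ = logTwo (suppProj A * τ).trace.re := by
  unfold relEntropyZero logTwo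
  by_cases h : suppProj A * suppProj τ = 0
  · rw [if_pos h, if_pos ((trace_suppProj_mul_eq_zero_iff A hτ).2 h), EReal.neg_top]
  · rw [if_neg h, if_neg (mt (trace_suppProj_mul_eq_zero_iff A hτ).1 h), EReal.coe_neg, neg_neg]

lemma kronecker_one_posSemidef {n d : ℕ} {σ : Matrix (Fin n) (Fin n) ℂ} (hσ : σ.PosSemidef) :
    (σ ⊗ₖ (1 : Matrix (Fin d) (Fin d) ℂ)).PosSemidef :=
  hσ.kronecker PosSemidef.one

/-- The conditional zero-entropy of a c-q operator is the logarithm of its largest block rank. -/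
lemma condEntropyZero_cqOp {n d : ℕ} (w : Fin n → Matrix (Fin d) (Fin d) ℂ) :
    condEntropyZero (cqOp w) = ⨆ i, logTwo (w i).rank := by
  have key : ∀ σ : Matrix (Fin n) (Fin n) ℂ, σ.PosSemidef →
      -relEntropyZero (cqOp w) (σ ⊗ₖ (1 : Matrix (Fin d) (Fin d) ℂ)) =
        logTwo (∑ i, (σ i i).re * (w i).rank) := by
    intro σ hσ
    rw [neg_relEntropyZero _ (kronecker_one_posSemidef hσ), suppProj_cqOp,
      trace_cqOp_mul_kronecker_one]
    simp [trace_suppProj]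
  -- By `key` each value is the logarithm of an average of the block ranks with weights `σ i i`. An
  -- average is at most the largest rank, and the basis state `|j⟩⟨j|` puts all the weight on block
  -- `j`.
  apply le_antisymm
  · refine iSup₂_le fun σ hσ => ?_
    rw [key σ hσ.1]
    have hsum : ∑ i, (σ i i).re = 1 := by
      have := congrArg Complex.re hσ.2
      simpa [trace] using this
    have hne : (Finset.univ : Finset (Fin n)).Nonempty := by
      by_contra h
      rw [Finset.not_nonempty_iff_eq_empty] at h
      simp [h] at hsum
    have hnn : ∀ i, 0 ≤ (σ i i).re := fun i => (Complex.le_def.1 hσ.1.diag_nonneg).1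
    obtain ⟨j, -, hj⟩ := Finset.exists_max_image Finset.univ (fun i => (w i).rank) hne
    refine le_trans (logTwo_mono (y := ((w j).rank : ℝ)) ?_ ?_)
      (le_iSup (fun i => logTwo (w i).rank) j)
    · exact Finset.sum_nonneg fun i _ => mul_nonneg (hnn i) (Nat.cast_nonneg _)
    · calc ∑ i, (σ i i).re * ((w i).rank : ℝ) ≤ ∑ i, (σ i i).re * ((w j).rank : ℝ) :=
          Finset.sum_le_sum fun i hi =>
            mul_le_mul_of_nonneg_left (Nat.cast_le.2 (hj i hi)) (hnn i)
        _ = _ := by rw [← Finset.sum_mul, hsum, one_mul]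
  · refine iSup_le fun j => ?_
    have hσ : IsState (single j j (1 : ℂ)) := by
      refine ⟨?_, by simp⟩
      rw [← diagonal_single]
      refine PosSemidef.diagonal fun i => ?_
      by_cases h : i = j
      · subst h; simp
      · simp [h]
    refine le_trans ?_ (le_iSup₂ (f := fun (σ : Matrix (Fin n) (Fin n) ℂ) (_ : IsState σ) =>
      -relEntropyZero (cqOp w) (σ ⊗ₖ (1 : Matrix (Fin d) (Fin d) ℂ))) _ hσ)
    rw [key _ hσ.1, Finset.sum_eq_single j]
    · simp
    · intro i _ hi
      simp [Ne.symm hi]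
    · simp

lemma condEntropyZero_cqOp_le_iff {n d : ℕ} (w : Fin n → Matrix (Fin d) (Fin d) ℂ) (M : ℕ) :
    condEntropyZero (cqOp w) ≤ logTwo M ↔ ∀ i, (w i).rank ≤ M := by
  rw [condEntropyZero_cqOp, iSup_le_iff]
  refine forall_congr' fun i => ⟨fun h => ?_, fun h => ?_⟩
  · exact_mod_cast le_of_logTwo_le (Nat.cast_nonneg M) h
  · exact logTwo_mono (Nat.cast_nonneg _) (Nat.cast_le.2 h)

/-- Only finitely many values occur for a given `d`; this is why the infima over balls and
decompositions are attained. -/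
lemma exists_condEntropyZero_cqOp_eq {n d : ℕ} (w : Fin n → Matrix (Fin d) (Fin d) ℂ) :
    ∃ M ≤ d, condEntropyZero (cqOp w) = logTwo (M : ℕ) := by
  rw [condEntropyZero_cqOp]
  rcases isEmpty_or_nonempty (Fin n) with h | h
  · exact ⟨0, Nat.zero_le _, by simp [logTwo_zero]⟩
  · obtain ⟨i, hi⟩ := exists_eq_ciSup_of_finite (f := fun i => logTwo (w i).rank)
    exact ⟨(w i).rank, by simpa using (w i).rank_le_width, hi.symm⟩

end Entropy

/-! ### Trace norm -/

section TraceNorm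

variable {α : Type} [Fintype α] [DecidableEq α]

lemma traceNorm_neg (X : Matrix α α ℂ) : traceNorm (-X) = traceNorm X := by
  simp [traceNorm]

lemma traceNorm_of_posSemidef {X : Matrix α α ℂ} (hX : X.PosSemidef) :
    traceNorm X = X.trace.re := by
  rw [traceNorm, hX.isHermitian.eq, CFC.sqrt_mul_self X hX.nonneg]

/-- Duality between the trace norm and effects. -/
lemma re_trace_mul_le_traceNorm {X Q : Matrix α α ℂ} (hX : Xᴴ = X) (hQ : Q.PosSemidef)
    (hQ1 : Q ≤ 1) : (Q * X).trace.re ≤ traceNorm X := by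
  have hXs : IsSelfAdjoint X := hX
  have hle : X ≤ CFC.abs X := by
    have h := CFC.abs_sub_self X hXs
    rw [← sub_nonneg, h, two_smul]
    exact add_nonneg (CFC.negPart_nonneg X) (CFC.negPart_nonneg X)
  have habs : (CFC.abs X).PosSemidef := nonneg_iff_posSemidef.1 (CFC.abs_nonneg X)
  -- Conjugating `X ≤ |X|` by `√Q` gives `Tr QX ≤ Tr Q|X|`; conjugating `Q ≤ 1` by `√|X|` gives `Tr
  -- Q|X| ≤ Tr |X|`.
  have h1 := trace_re_mono (conj_mono hle (CFC.sqrt Q))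
  have h2 := trace_re_mono (conj_mono hQ1 (CFC.sqrt (CFC.abs X)))
  rw [sqrt_isHermitian, trace_mul_comm, ← Matrix.mul_assoc, sqrt_mul_sqrt hQ,
    trace_mul_comm _ (CFC.sqrt Q), ← Matrix.mul_assoc, sqrt_mul_sqrt hQ] at h1
  rw [sqrt_isHermitian, Matrix.mul_one, sqrt_mul_sqrt habs, trace_mul_comm, ← Matrix.mul_assoc,
    sqrt_mul_sqrt habs, trace_mul_comm] at h2
  exact h1.trans h2

end TraceNorm

/-! ### Bipartite vectors as coefficient matrices -/

section Vectors

variable {a b : ℕ}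

/-- The coefficient matrix of a bipartite vector. -/
def toMat (v : Fin a × Fin b → ℂ) : Matrix (Fin a) (Fin b) ℂ := of fun i j => v (i, j)

lemma toMat_injective : Function.Injective (toMat : (Fin a × Fin b → ℂ) → _) := by
  intro v w h
  ext ⟨i, j⟩
  exact congrFun (congrFun h i) j

lemma toMat_smul (c : ℂ) (v : Fin a × Fin b → ℂ) : toMat (c • v) = c • toMat v := rfl

/-- Local operators become left and right multiplications, so they cannot raise the rank of the
coefficient matrix, which is the Schmidt rank. -/
lemma toMat_kronecker_mulVec {a' b' : ℕ} (A : Matrix (Fin a') (Fin a) ℂ)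
    (B : Matrix (Fin b') (Fin b) ℂ) (v : Fin a × Fin b → ℂ) :
    toMat ((A ⊗ₖ B) *ᵥ v) = A * toMat v * Bᵀ := by
  ext i j
  simp only [toMat, of_apply, mulVec, dotProduct, Fintype.sum_prod_type, kroneckerMap_apply,
    mul_apply, transpose_apply, Finset.sum_mul]
  rw [Finset.sum_comm]
  refine Finset.sum_congr rfl fun _ _ => Finset.sum_congr rfl fun _ _ => by ring

lemma trace_conjTranspose_mul_toMat (v w : Fin a × Fin b → ℂ) :
    ((toMat v)ᴴ * toMat w).trace = star v ⬝ᵥ w := by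
  simp only [trace, diag, mul_apply, conjTranspose_apply, toMat, of_apply, dotProduct,
    Fintype.sum_prod_type, Pi.star_apply]
  exact Finset.sum_comm

lemma reduceA_ketbra (v : Fin a × Fin b → ℂ) : reduceA (ketbra v) = toMat v * (toMat v)ᴴ := by
  ext i j
  simp [reduceA, ketbra, toMat, mul_apply, vecMulVec_apply]

variable {α β : Type}

lemma ketbra_smul (c : ℂ) (v : α → ℂ) : ketbra (c • v) = (c * star c) • ketbra v := by
  ext i j
  simp [ketbra, vecMulVec_apply]
  ring

lemma ketbra_zero : ketbra (0 : α → ℂ) = 0 := by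
  ext i j
  simp [ketbra, vecMulVec_apply]

lemma sum_ketbra_eq {ι : Type} [Fintype ι] (v : ι → α → ℂ) :
    ∑ k, ketbra (v k) = (of fun i k => v k i) * (of fun i k => v k i)ᴴ := by
  ext i j
  simp [ketbra, mul_apply, vecMulVec_apply, Matrix.sum_apply]

variable [Fintype α]

lemma mul_ketbra_mul_conjTranspose (K : Matrix β α ℂ) (v : α → ℂ) :
    K * ketbra v * Kᴴ = ketbra (K *ᵥ v) := by
  rw [ketbra, mul_vecMulVec, vecMulVec_mul, ketbra, star_mulVec]

lemma trace_ketbra (v : α → ℂ) : (ketbra v).trace = star v ⬝ᵥ v := by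
  rw [ketbra, trace_vecMulVec, dotProduct_comm]

lemma ketbra_posSemidef (v : α → ℂ) : (ketbra v).PosSemidef := posSemidef_vecMulVec_self_star v

end Vectors

/-! ### LOCC, Schmidt rank and the preparation of pure states -/

/-- LOCC maps send pure states to mixtures of pure states of no larger Schmidt rank. -/
lemma IsLOCC.exists_ensemble {dA dB m n : ℕ} {Λ : BipMat m n → BipMat dA dB}
    (hΛ : IsLOCC dA dB m n Λ) (M : ℕ) (v : Fin m × Fin n → ℂ) (hv : (toMat v).rank ≤ M) :
    ∃ (ι : Type) (_ : Fintype ι) (u : ι → Fin dA × Fin dB → ℂ),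
      Λ (ketbra v) = ∑ k, ketbra (u k) ∧ (∀ k, (toMat (u k)).rank ≤ M) ∧
        ∑ k, star (u k) ⬝ᵥ u k = star v ⬝ᵥ v := by
  induction hΛ with
  | done => exact ⟨Unit, inferInstance, fun _ => v, by simp, fun _ => hv, by simp⟩
  | @alice m n q m' K hK Λ hΛ ih =>
    have hr : ∀ x, (toMat ((K x ⊗ₖ (1 : Matrix (Fin n) (Fin n) ℂ)) *ᵥ v)).rank ≤ M := by
      intro x
      rw [toMat_kronecker_mulVec, transpose_one, Matrix.mul_one]
      exact (rank_mul_le_right _ _).trans hv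
    choose ι hι u hu hur hun using fun x => ih x _ (hr x)
    refine ⟨Σ x, ι x, inferInstance, fun k => u k.1 k.2, ?_, fun k => hur _ _, ?_⟩
    · rw [Fintype.sum_sigma]
      exact Finset.sum_congr rfl fun x _ => by rw [mul_ketbra_mul_conjTranspose, hu]
    · rw [Fintype.sum_sigma]
      simp only [hun]
      simp only [← trace_conjTranspose_mul_toMat, toMat_kronecker_mulVec, transpose_one,
        Matrix.mul_one, conjTranspose_mul]
      rw [← trace_sum]
      simp only [Matrix.mul_assoc]
      rw [← Matrix.mul_sum]
      simp only [← Matrix.mul_assoc (K _)ᴴ]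
      rw [← Matrix.sum_mul, hK, Matrix.one_mul]
  | @bob m n q n' K hK Λ hΛ ih =>
    have hr : ∀ x, (toMat (((1 : Matrix (Fin m) (Fin m) ℂ) ⊗ₖ K x) *ᵥ v)).rank ≤ M := by
      intro x
      rw [toMat_kronecker_mulVec, Matrix.one_mul]
      exact (rank_mul_le_left _ _).trans hv
    choose ι hι u hu hur hun using fun x => ih x _ (hr x)
    refine ⟨Σ x, ι x, inferInstance, fun k => u k.1 k.2, ?_, fun k => hur _ _, ?_⟩
    · rw [Fintype.sum_sigma]
      exact Finset.sum_congr rfl fun x _ => by rw [mul_ketbra_mul_conjTranspose, hu]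
    · rw [Fintype.sum_sigma]
      -- Bob's operators act on coefficient matrices from the right as transposes, so his
      -- completeness relation is needed in transposed form.
      have hK' : ∑ x, (K x)ᵀ * (K x)ᵀᴴ = 1 := by
        have := congrArg transpose hK
        rw [transpose_sum, transpose_one] at this
        rw [← this]
        exact Finset.sum_congr rfl fun x _ => by rw [transpose_mul]; rfl
      simp only [hun]
      simp only [← trace_conjTranspose_mul_toMat, toMat_kronecker_mulVec,
        Matrix.one_mul]
      rw [trace_mul_comm (toMat v)ᴴ, Finset.sum_congr rfl fun x _ => trace_mul_comm _ _]
      simp only [conjTranspose_mul]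
      rw [← trace_sum]
      simp only [Matrix.mul_assoc]
      rw [← Matrix.mul_sum]
      simp only [← Matrix.mul_assoc (K _)ᵀ]
      rw [← Matrix.sum_mul, hK', Matrix.one_mul]

/-- The Schmidt decomposition, padded to `M` terms. -/
lemma exists_schmidt_factorization {a b M : ℕ} (C : Matrix (Fin a) (Fin b) ℂ) (hC : C.rank ≤ M) :
    ∃ (G : Matrix (Fin a) (Fin M) ℂ) (W : Matrix (Fin M) (Fin b) ℂ) (ν : Fin M → ℂ)
      (s : Set (Fin M)), G * W = C ∧ Gᴴ * G = diagonal ν ∧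
      W * Wᴴ = diagonal (s.indicator 1) ∧ (∀ j ∉ s, ∀ i, G i j = 0) := by
  classical
  have hH : (Cᴴ * C).IsHermitian := isHermitian_conjTranspose_mul_self C
  set μ := hH.eigenvalues with hμ
  set U : Matrix (Fin b) (Fin b) ℂ := hH.eigenvectorUnitary.1 with hU
  have hUU : Uᴴ * U = 1 := Unitary.coe_star_mul_self hH.eigenvectorUnitary
  have hUU' : U * Uᴴ = 1 := Unitary.coe_mul_star_self hH.eigenvectorUnitary
  have hsp : Cᴴ * C = U * diagonal (fun i => (μ i : ℂ)) * Uᴴ := hH.spectral_theorem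
  have hdiag : (C * U)ᴴ * (C * U) = diagonal (fun i => (μ i : ℂ)) := by
    rw [conjTranspose_mul, Matrix.mul_assoc, ← Matrix.mul_assoc Cᴴ, hsp]
    simp only [← Matrix.mul_assoc]
    rw [hUU, Matrix.one_mul, Matrix.mul_assoc, hUU, Matrix.mul_one]
  have hzero : ∀ i, μ i = 0 → ∀ x, (C * U) x i = 0 := by
    intro i hi x
    have h := congrFun (congrFun hdiag i) i
    rw [diagonal_apply_eq, hi, mul_apply] at h
    simp only [conjTranspose_apply, Complex.ofReal_zero] at h
    have h2 : ∑ x, Complex.normSq ((C * U) x i) = 0 := by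
      apply Complex.ofReal_injective
      rw [Complex.ofReal_zero, ← h, Complex.ofReal_sum]
      exact Finset.sum_congr rfl fun y _ => by
        rw [Complex.normSq_eq_conj_mul_self]; rfl
    have := (Finset.sum_eq_zero_iff_of_nonneg (fun y _ => Complex.normSq_nonneg _)).1 h2 x
      (Finset.mem_univ x)
    exact Complex.normSq_eq_zero.1 this
  have hcard : Fintype.card {i // μ i ≠ 0} ≤ Fintype.card (Fin M) := by
    rw [← hH.rank_eq_card_non_zero_eigs, rank_conjTranspose_mul_self, Fintype.card_fin]
    exact hC
  obtain ⟨e⟩ := Function.Embedding.nonempty_of_card_le hcard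
  -- `J` places the right singular vectors with nonzero singular value into distinct slots among
  -- `M`. Inserting `J * Jᴴ` after `C * U` changes nothing, because the discarded columns of `C * U`
  -- vanish. Slots outside the range of `e` stay empty.
  let J : Matrix (Fin b) (Fin M) ℂ := of fun i j => if ∃ h : μ i ≠ 0, e ⟨i, h⟩ = j then 1 else 0
  have hJ : ∀ i j, J i j = if ∃ h : μ i ≠ 0, e ⟨i, h⟩ = j then 1 else 0 := fun _ _ => rfl
  have hJJ : J * Jᴴ = diagonal ({i | μ i ≠ 0}.indicator 1) := by
    ext i i'
    simp only [mul_apply, conjTranspose_apply, hJ, diagonal_apply, Set.indicator_apply]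
    by_cases hi : μ i ≠ 0
    · rw [Finset.sum_eq_single (e ⟨i, hi⟩)]
      · by_cases hii : i = i'
        · subst hii; simp [hi]
        · have : ¬ ∃ h : μ i' ≠ 0, e ⟨i', h⟩ = e ⟨i, hi⟩ := by
            rintro ⟨h, h'⟩
            exact hii (congrArg Subtype.val (e.injective h')).symm
          rw [if_neg this]
          simp [hii]
      · intro j _ hj
        have : ¬ ∃ h : μ i ≠ 0, e ⟨i, h⟩ = j := by
          rintro ⟨_, h'⟩
          exact hj h'.symm
        rw [if_neg this, zero_mul]
      · simp
    · simp [hi]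
  have hJdJ : ∀ f : Fin b → ℂ, Jᴴ * diagonal f * J =
      diagonal fun j => ∑ i, if ∃ h : μ i ≠ 0, e ⟨i, h⟩ = j then f i else 0 := by
    intro f
    ext j j'
    rw [mul_apply]
    simp only [mul_diagonal, conjTranspose_apply, hJ, diagonal_apply]
    by_cases hj : j = j'
    · subst hj
      rw [if_pos rfl]
      refine Finset.sum_congr rfl fun i _ => ?_
      split_ifs <;> simp
    · rw [if_neg hj]
      refine Finset.sum_eq_zero fun i _ => ?_
      by_cases h1 : ∃ h : μ i ≠ 0, e ⟨i, h⟩ = j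
      · have : ¬ ∃ h : μ i ≠ 0, e ⟨i, h⟩ = j' := by
          rintro ⟨_, h'⟩
          obtain ⟨_, h''⟩ := h1
          exact hj (h''.symm.trans h')
        rw [if_neg this, mul_zero]
      · rw [if_neg h1]; simp
  have hCUJ : C * U * (J * Jᴴ) = C * U := by
    ext x i
    rw [hJJ, mul_diagonal, Set.indicator_apply]
    by_cases hi : μ i = 0
    · simp [hzero i hi]
    · simp [hi]
  refine ⟨C * U * J, Jᴴ * Uᴴ,
    fun j => ∑ i, if ∃ h : μ i ≠ 0, e ⟨i, h⟩ = j then (μ i : ℂ) else 0, Set.range e, ?_, ?_, ?_, ?_⟩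
  · rw [Matrix.mul_assoc, ← Matrix.mul_assoc J, ← Matrix.mul_assoc, hCUJ, Matrix.mul_assoc, hUU',
      Matrix.mul_one]
  · rw [conjTranspose_mul, Matrix.mul_assoc, ← Matrix.mul_assoc (C * U)ᴴ, hdiag,
      ← Matrix.mul_assoc, hJdJ]
  · have h1 : Jᴴ * Uᴴ * (Jᴴ * Uᴴ)ᴴ = Jᴴ * diagonal (fun _ : Fin b => (1 : ℂ)) * J := by
      rw [conjTranspose_mul, conjTranspose_conjTranspose, conjTranspose_conjTranspose,
        Matrix.mul_assoc, ← Matrix.mul_assoc Uᴴ, hUU, Matrix.one_mul, diagonal_one, Matrix.mul_one]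
    rw [h1, hJdJ]
    congr 1
    funext j
    by_cases hj : j ∈ Set.range e
    · obtain ⟨⟨i, hi⟩, rfl⟩ := hj
      rw [Set.indicator_of_mem (Set.mem_range_self _), Finset.sum_eq_single i]
      · simp [hi]
      · intro i' _ hne
        rw [if_neg]
        rintro ⟨h, h'⟩
        exact hne (congrArg Subtype.val (e.injective h'))
      · simp
    · rw [Set.indicator_of_notMem hj]
      refine Finset.sum_eq_zero fun i _ => ?_
      rw [if_neg]
      rintro ⟨h, h'⟩
      exact hj ⟨_, h'⟩
  · intro j hj x
    rw [mul_apply]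
    refine Finset.sum_eq_zero fun i _ => ?_
    rw [hJ, if_neg, mul_zero]
    rintro ⟨h, h'⟩
    exact hj ⟨_, h'⟩

lemma maxEntangled_eq (M : ℕ) : ∃ ψ : Fin M × Fin M → ℂ,
    maxEntangled M = ketbra ψ ∧ toMat ψ = (((Real.sqrt M)⁻¹ : ℝ) : ℂ) • 1 := by
  refine ⟨_, rfl, ?_⟩
  ext i j
  by_cases h : i = j
  · simp [toMat, h]
  · simp [toMat, h, one_apply_ne h]

lemma sqrt_inv_mul_star_self {M : ℕ} (hM : M ≠ 0) :
    (M : ℂ) * ((((Real.sqrt M)⁻¹ : ℝ) : ℂ) * star (((Real.sqrt M)⁻¹ : ℝ) : ℂ)) = 1 := by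
  have hM' : (0 : ℝ) < M := by exact_mod_cast Nat.pos_of_ne_zero hM
  have : (M : ℝ) * ((Real.sqrt M)⁻¹ * (Real.sqrt M)⁻¹) = 1 := by
    rw [← mul_inv, Real.mul_self_sqrt hM'.le, mul_inv_cancel₀ hM'.ne']
  rw [Complex.star_def, Complex.conj_ofReal]
  exact_mod_cast this

/-- A pure state of Schmidt rank at most `M` can be prepared from the maximally entangled state of
rank `M`: Alice measures with cyclic shifts of the Schmidt coefficients, Bob corrects. -/
lemma exists_isLOCC_prepare {a b M : ℕ} (hM : M ≠ 0) (v : Fin a × Fin b → ℂ)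
    (hv : star v ⬝ᵥ v = 1) (hr : (toMat v).rank ≤ M) :
    ∃ Λ : BipMat M M → BipMat a b, IsLOCC a b M M Λ ∧
      ∀ c : ℂ, Λ (c • maxEntangled M) = c • ketbra v := by
  classical
  have : NeZero M := ⟨hM⟩
  obtain ⟨G, W, ν, s, hGW, hG, hW, hs⟩ := exists_schmidt_factorization (toMat v) hr
  have hb : 0 < b := by
    rcases Nat.eq_zero_or_pos b with rfl | h
    · simp [dotProduct] at hv
    · exact h
  have hν : ∑ j, ν j = 1 := by
    have h1 : ((toMat v)ᴴ * toMat v).trace = ∑ j, ν j * s.indicator 1 j := by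
      rw [← hGW, conjTranspose_mul, Matrix.mul_assoc, ← Matrix.mul_assoc Gᴴ, hG, trace_mul_comm,
        Matrix.mul_assoc, hW, diagonal_mul_diagonal, trace_diagonal]
    rw [trace_conjTranspose_mul_toMat, hv] at h1
    rw [h1]
    refine Finset.sum_congr rfl fun j _ => ?_
    by_cases hj : j ∈ s
    · simp [hj]
    · have h := congrFun (congrFun hG j) j
      rw [diagonal_apply_eq, mul_apply] at h
      rw [← h]
      simp [hs j hj]
  -- Addition in `Fin M` is cyclic, so over all shifts each diagonal entry of `∑ (A k)ᴴ * A k`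
  -- collects every `ν j` once and equals `∑ ν = 1`.
  let A : Fin M → Matrix (Fin a) (Fin M) ℂ := fun k => G.submatrix id (· + k)
  -- Outcome `0` undoes Alice's shift. The rows of `W` in empty slots are zero, so the outcomes `l ∉
  -- s` are added to complete the measurement; they never occur, as column `l` of `G` is then zero.
  let B : Fin M → Fin (M + 1) → Matrix (Fin b) (Fin M) ℂ := fun k =>
    Fin.cons (Wᵀ.submatrix id (· + k))
      fun l => of fun y j => if y = ⟨0, hb⟩ ∧ j + k = l ∧ l ∉ s then 1 else 0
  have hA : ∑ k, (A k)ᴴ * A k = 1 := by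
    ext j j'
    have e : ∀ k, ((A k)ᴴ * A k) j j' = if j = j' then ν (j + k) else 0 := by
      intro k
      have : ((A k)ᴴ * A k) j j' = (Gᴴ * G) (j + k) (j' + k) := rfl
      rw [this, hG, diagonal_apply]
      simp
    rw [Matrix.sum_apply]
    simp only [e, one_apply]
    split_ifs
    · rw [← hν]
      exact Equiv.sum_comp (Equiv.addLeft j) ν
    · simp
  have hB : ∀ k, ∑ l, (B k l)ᴴ * B k l = 1 := by
    intro k
    rw [Fin.sum_univ_succ]
    ext j j'
    have e0 : ((B k 0)ᴴ * B k 0) j j' = if j = j' then s.indicator 1 (j + k) else 0 := by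
      have : ((B k 0)ᴴ * B k 0) j j' = (W * Wᴴ) (j' + k) (j + k) := by
        simp only [mul_apply, conjTranspose_apply]
        exact Finset.sum_congr rfl fun _ _ => mul_comm _ _
      rw [this, hW, diagonal_apply]
      by_cases h : j = j'
      · subst h; simp
      · simp [h, Ne.symm h]
    have e1 : ∀ l : Fin M, ((B k l.succ)ᴴ * B k l.succ) j j' =
        if j + k = l ∧ j' + k = l ∧ l ∉ s then 1 else 0 := by
      intro l
      simp only [mul_apply, conjTranspose_apply, B, Fin.cons_succ, of_apply]
      rw [Finset.sum_eq_single ⟨0, hb⟩]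
      · by_cases h1 : j + k = l <;> by_cases h2 : j' + k = l <;> by_cases h3 : l ∈ s <;>
          simp [h1, h2, h3]
      · intro y _ hy
        simp [hy]
      · simp
    rw [Matrix.add_apply, Matrix.sum_apply, e0]
    simp only [e1]
    rw [Finset.sum_eq_single (j + k)]
    · by_cases h : j = j'
      · subst h
        by_cases h2 : j + k ∈ s <;> simp [h2]
      · simp [h, Ne.symm h]
    · intro l _ hl
      simp [Ne.symm hl]
    · simp
  refine ⟨_, IsLOCC.alice M (fun _ => a) A hA _ fun k =>
    IsLOCC.bob (M + 1) (fun _ => b) (B k) (hB k) _ fun _ => IsLOCC.done, fun c => ?_⟩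
  obtain ⟨ψ, hψ, hψm⟩ := maxEntangled_eq M
  set t : ℂ := (((Real.sqrt M)⁻¹ : ℝ) : ℂ) with ht
  have hu0 : ∀ k, ((1 : Matrix (Fin a) (Fin a) ℂ) ⊗ₖ B k 0) *ᵥ
      ((A k ⊗ₖ (1 : Matrix (Fin M) (Fin M) ℂ)) *ᵥ ψ) = t • v := by
    intro k
    apply toMat_injective
    rw [toMat_kronecker_mulVec, toMat_kronecker_mulVec, hψm, toMat_smul, transpose_one,
      Matrix.mul_one, Matrix.one_mul, Matrix.mul_smul, Matrix.smul_mul, Matrix.mul_one, ← hGW]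
    congr 1
    ext x y
    simp only [mul_apply]
    exact Equiv.sum_comp (Equiv.addRight k) (fun j => G x j * W j y)
  have hu1 : ∀ k (l : Fin M), ((1 : Matrix (Fin a) (Fin a) ℂ) ⊗ₖ B k l.succ) *ᵥ
      ((A k ⊗ₖ (1 : Matrix (Fin M) (Fin M) ℂ)) *ᵥ ψ) = 0 := by
    intro k l
    apply toMat_injective
    rw [toMat_kronecker_mulVec, toMat_kronecker_mulVec, hψm, transpose_one,
      Matrix.mul_one, Matrix.one_mul, Matrix.mul_smul, Matrix.smul_mul, Matrix.mul_one]
    have : A k * (B k l.succ)ᵀ = 0 := by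
      ext x y
      simp only [mul_apply, transpose_apply, B, Fin.cons_succ, of_apply, Matrix.zero_apply]
      refine Finset.sum_eq_zero fun j _ => ?_
      split_ifs with h
      · obtain ⟨-, rfl, h3⟩ := h
        simp [A, hs _ h3]
      · simp
    rw [this, smul_zero]
    rfl
  rw [hψ]
  simp only [Matrix.mul_smul, Matrix.smul_mul, mul_ketbra_mul_conjTranspose, Fin.sum_univ_succ, hu0,
    hu1, ketbra_zero, smul_zero, Finset.sum_const_zero, add_zero, ketbra_smul, Finset.sum_const,
    Finset.card_univ, Fintype.card_fin]
  -- Each of Alice's `M` outcomes contributes the target projector with weight `1 / M`.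
  rw [← Nat.cast_smul_eq_nsmul ℂ, smul_comm c, smul_smul, sqrt_inv_mul_star_self hM, one_smul]

/-- Mixtures of pure states of Schmidt rank at most `M` can be prepared from the maximally
entangled state of rank `M`. -/
lemma exists_isLOCC_prepare_mixture {a b M n : ℕ} (hM : M ≠ 0) (p : Fin n → ℝ)
    (hp : ∀ i, 0 ≤ p i) (hp1 : ∑ i, p i = 1) (v : Fin n → Fin a × Fin b → ℂ)
    (hv : ∀ i, star (v i) ⬝ᵥ v i = 1) (hr : ∀ i, (toMat (v i)).rank ≤ M) :
    ∃ Λ : BipMat M M → BipMat a b, IsLOCC a b M M Λ ∧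
      Λ (maxEntangled M) = ∑ i, (p i : ℂ) • ketbra (v i) := by
  choose Λ hΛ hΛv using fun i => exists_isLOCC_prepare hM (v i) (hv i) (hr i)
  have hsq : ∀ i, ((Real.sqrt (p i) : ℝ) : ℂ) * ((Real.sqrt (p i) : ℝ) : ℂ) = (p i : ℂ) := by
    intro i
    rw [← Complex.ofReal_mul, Real.mul_self_sqrt (hp i)]
  have hst : ∀ i, star ((Real.sqrt (p i) : ℝ) : ℂ) = ((Real.sqrt (p i) : ℝ) : ℂ) := fun i =>
    Complex.conj_ofReal _
  -- Alice draws `i` with probability `p i` by Kraus operators proportional to the identity. The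
  -- branch then receives `p i` times the entangled state, which is why the protocols were required
  -- to commute with scalars on it.
  have hK : ∑ i, (((Real.sqrt (p i) : ℝ) : ℂ) • (1 : Matrix (Fin M) (Fin M) ℂ))ᴴ *
      (((Real.sqrt (p i) : ℝ) : ℂ) • (1 : Matrix (Fin M) (Fin M) ℂ)) = 1 := by
    simp only [conjTranspose_smul, conjTranspose_one, Matrix.mul_smul, Matrix.mul_one,
      smul_smul, hst, hsq]
    rw [← Finset.sum_smul, ← Complex.ofReal_sum, hp1, Complex.ofReal_one, one_smul]
  refine ⟨_, IsLOCC.alice n (fun _ => M) _ hK Λ hΛ, ?_⟩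
  refine Finset.sum_congr rfl fun i _ => ?_
  rw [← hΛv i, smul_kronecker, one_kronecker_one, conjTranspose_smul, conjTranspose_one,
    Matrix.smul_mul, Matrix.one_mul, Matrix.mul_smul, Matrix.mul_one, smul_smul, hst, hsq]

/-! ### Normalising ensembles -/

section Decompositions

variable {dA dB n : ℕ}

lemma reduceRA_cqExtension (p : Fin n → ℝ) (φ : Fin n → Fin dA × Fin dB → ℂ) :
    reduceRA (cqExtension p φ) = cqOp fun i => reduceA ((p i : ℂ) • ketbra (φ i)) := by
  ext x y
  simp only [reduceRA, cqExtension, of_apply, cqOp_apply, reduceA]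
  split_ifs <;> simp

lemma reduceA_smul (c : ℂ) (ρ : BipMat dA dB) : reduceA (c • ρ) = c • reduceA ρ := by
  ext x y
  simp [reduceA, Finset.mul_sum]

lemma trace_reduceA (ρ : BipMat dA dB) : (reduceA ρ).trace = ρ.trace := by
  simp [trace, reduceA, Fintype.sum_prod_type]

lemma reduceA_smul_ketbra_posSemidef {p : ℝ} (hp : 0 ≤ p) (φ : Fin dA × Fin dB → ℂ) :
    (reduceA ((p : ℂ) • ketbra φ)).PosSemidef := by
  rw [reduceA_smul, reduceA_ketbra]
  exact (posSemidef_self_mul_conjTranspose _).smul (by exact_mod_cast hp)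

/-- Every unnormalised ensemble of a state can be normalised. -/
lemma exists_isDecomposition {ρ : BipMat dA dB} (hρ : IsState ρ) {ι : Type} [Fintype ι]
    (x : ι → Fin dA × Fin dB → ℂ) (hx : ∑ k, ketbra (x k) = ρ) :
    ∃ (n : ℕ) (e : Fin n ≃ ι) (p : Fin n → ℝ) (φ : Fin n → Fin dA × Fin dB → ℂ),
      IsDecomposition ρ p φ ∧ ∀ i, (p i : ℂ) • ketbra (φ i) = ketbra (x (e i)) := by
  have hne : Nonempty (Fin dA × Fin dB) := by
    by_contra h
    rw [not_nonempty_iff] at h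
    simpa [trace] using hρ.2
  have hone : ∀ k, ∃ (q : ℝ) (φ : Fin dA × Fin dB → ℂ), 0 ≤ q ∧ star φ ⬝ᵥ φ = 1 ∧
      (q : ℂ) • ketbra φ = ketbra (x k) := by
    intro k
    -- A zero vector gets weight 0 and an arbitrary unit vector.
    by_cases hk : x k = 0
    · obtain ⟨y⟩ := hne
      exact ⟨0, Pi.single y 1, le_rfl, by simp, by simp [hk, ketbra_zero]⟩
    · have hn : 0 ≤ star (x k) ⬝ᵥ x k := dotProduct_star_self_nonneg _
      have hne : star (x k) ⬝ᵥ x k ≠ 0 := by rwa [Ne, dotProduct_star_self_eq_zero]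
      set q := (star (x k) ⬝ᵥ x k).re with hq
      have hqc : (q : ℂ) = star (x k) ⬝ᵥ x k :=
        Complex.ext rfl (by simpa using (Complex.le_def.1 hn).2)
      have hq0 : 0 ≤ q := (Complex.le_def.1 hn).1
      have hqne : q ≠ 0 := by
        intro h
        rw [h, Complex.ofReal_zero] at hqc
        exact hne hqc.symm
      have hqpos : 0 < q := lt_of_le_of_ne hq0 (Ne.symm hqne)
      have hsq : (((Real.sqrt q)⁻¹ : ℝ) : ℂ) * (((Real.sqrt q)⁻¹ : ℝ) : ℂ) = (q : ℂ)⁻¹ := by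
        rw [← Complex.ofReal_mul, ← mul_inv, Real.mul_self_sqrt hq0, Complex.ofReal_inv]
      have hqne' : (q : ℂ) ≠ 0 := Complex.ofReal_ne_zero.2 hqne
      refine ⟨q, (((Real.sqrt q)⁻¹ : ℝ) : ℂ) • x k, hq0, ?_, ?_⟩
      · rw [star_smul, smul_dotProduct, dotProduct_smul, smul_smul, Complex.star_def,
          Complex.conj_ofReal, hsq, ← hqc, smul_eq_mul, inv_mul_cancel₀ hqne']
      · rw [ketbra_smul, Complex.star_def, Complex.conj_ofReal, hsq, smul_smul,
          mul_inv_cancel₀ hqne', one_smul]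
  choose q φ hq hφ hqφ using hone
  let e : Fin (Fintype.card ι) ≃ ι := (Fintype.equivFin ι).symm
  refine ⟨_, e, fun i => q (e i), fun i => φ (e i), ⟨fun i => hq _, ?_, fun i => hφ _, ?_⟩,
    fun i => hqφ _⟩
  · have h : ∑ k, (q k : ℂ) = 1 := by
      rw [← hρ.2, ← hx, trace_sum]
      refine Finset.sum_congr rfl fun k _ => ?_
      rw [← hqφ, trace_smul, trace_ketbra, hφ, smul_eq_mul, mul_one]
    rw [Equiv.sum_comp e q]
    exact_mod_cast h
  · simp only [hqφ]
    rw [Equiv.sum_comp e fun k => ketbra (x k), hx]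

lemma sum_ketbra_columns {α ι : Type} [Fintype ι] (X : Matrix α ι ℂ) :
    ∑ k, ketbra (fun i => X i k) = X * Xᴴ := by
  rw [sum_ketbra_eq]
  rfl

lemma exists_isDecomposition_of_isState {ρ : BipMat dA dB} (hρ : IsState ρ) :
    ∃ (n : ℕ) (p : Fin n → ℝ) (φ : Fin n → Fin dA × Fin dB → ℂ), IsDecomposition ρ p φ := by
  obtain ⟨n, -, p, φ, h, -⟩ := exists_isDecomposition hρ (fun k i => CFC.sqrt ρ i k) (by
    rw [sum_ketbra_columns, sqrt_isHermitian, sqrt_mul_sqrt hρ.1])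
  exact ⟨n, p, φ, h⟩

end Decompositions

/-! ### From a protocol to a nearby c-q operator of small block rank -/

section Converse

lemma traceNorm_nonneg {α : Type} [Fintype α] [DecidableEq α] (X : Matrix α α ℂ) :
    0 ≤ traceNorm X :=
  (Complex.le_def.1 (sqrt_posSemidef _).trace_nonneg).1

lemma re_trace_conjTranspose_mul_self_nonneg {α β : Type} [Fintype α] [Fintype β]
    (A : Matrix α β ℂ) : 0 ≤ (Aᴴ * A).trace.re :=
  (Complex.le_def.1 (posSemidef_conjTranspose_mul_self A).trace_nonneg).1

/-- Cauchy–Schwarz for families of matrices, the first family being normalised. -/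
lemma sq_sum_re_trace_le {ι α β : Type} [Fintype ι] [Fintype α] [Fintype β]
    (A B : ι → Matrix α β ℂ) (hA : ∑ k, ((A k)ᴴ * A k).trace.re = 1) :
    (∑ k, ((A k)ᴴ * B k).trace.re) ^ 2 ≤ ∑ k, ((B k)ᴴ * B k).trace.re := by
  set F := ∑ k, ((A k)ᴴ * B k).trace.re with hF
  -- Summed over `k`, these squares give `∑ ‖B k‖² - 2F² + F² ≥ 0`.
  have h : ∀ k, ((B k - (F : ℂ) • A k)ᴴ * (B k - (F : ℂ) • A k)).trace.re =
      ((B k)ᴴ * B k).trace.re - 2 * F * ((A k)ᴴ * B k).trace.re +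
        F ^ 2 * ((A k)ᴴ * A k).trace.re := by
    intro k
    have hc : ((B k)ᴴ * A k).trace.re = ((A k)ᴴ * B k).trace.re := by
      have : (B k)ᴴ * A k = ((A k)ᴴ * B k)ᴴ := by simp
      rw [this, trace_conjTranspose]
      simp
    simp only [conjTranspose_sub, conjTranspose_smul, Matrix.sub_mul, Matrix.mul_sub,
      Matrix.smul_mul, Matrix.mul_smul, trace_sub, trace_smul, Complex.sub_re, smul_eq_mul,
      Complex.star_def, Complex.conj_ofReal, Complex.re_ofReal_mul, hc]
    ring
  have h0 : 0 ≤ ∑ k, ((B k - (F : ℂ) • A k)ᴴ * (B k - (F : ℂ) • A k)).trace.re :=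
    Finset.sum_nonneg fun k _ => re_trace_conjTranspose_mul_self_nonneg _
  simp only [h, Finset.sum_add_distrib, Finset.sum_sub_distrib, ← Finset.mul_sum, hA, ← hF] at h0
  nlinarith

variable {dA dB : ℕ}

/-- If an ensemble of vectors of Schmidt rank at most `M` has fidelity `F` with `ρ`, then a
decomposition of `ρ` has a c-q operator with blocks of rank at most `M` within `1 - F²`. -/
lemma exists_decomposition_near {ρ : BipMat dA dB} (hρ : IsState ρ) {ι : Type} [Fintype ι] {M : ℕ}
    (u : ι → Fin dA × Fin dB → ℂ) (hur : ∀ k, (toMat (u k)).rank ≤ M)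
    (hu : ∑ k, star (u k) ⬝ᵥ u k = 1) :
    ∃ (n : ℕ) (p : Fin n → ℝ) (φ : Fin n → Fin dA × Fin dB → ℂ)
      (w : Fin n → Matrix (Fin dA) (Fin dA) ℂ), IsDecomposition ρ p φ ∧
      (∀ i, (w i).PosSemidef) ∧ (∀ i, (w i).rank ≤ M) ∧
      traceNorm (cqOp w - reduceRA (cqExtension p φ)) ≤
        1 - fidelity (∑ k, ketbra (u k)) ρ ^ 2 := by
  rw [sum_ketbra_eq]
  set V : Matrix (Fin dA × Fin dB) ι ℂ := of fun i k => u k i with hV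
  obtain ⟨X, hX, hF⟩ := exists_re_trace_eq_fidelity V hρ.1
  rw [← hF]
  let x : ι → Fin dA × Fin dB → ℂ := fun k i => X i k
  -- The columns of `√(ρ - X Xᴴ)` complete the columns of `X` to an ensemble of `ρ`; their blocks in
  -- `w` are set to zero.
  let r : Fin dA × Fin dB → Fin dA × Fin dB → ℂ := fun k i => CFC.sqrt (ρ - X * Xᴴ) i k
  have hsum : ∑ k, ketbra (Sum.elim x r k) = ρ := by
    rw [Fintype.sum_sum_type]
    simp only [Sum.elim_inl, Sum.elim_inr, x, r]
    rw [sum_ketbra_columns, sum_ketbra_columns, sqrt_isHermitian, sqrt_mul_sqrt (le_iff.1 hX)]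
    abel
  obtain ⟨n, e, p, φ, hdec, hpφ⟩ := exists_isDecomposition hρ _ hsum
  -- `Q k` has rank at most that of `toMat (u k)`, and replacing `x k` by its compression `toMat (x
  -- k) * Q k` keeps the overlap with `u k`.
  let Q : ι → Matrix (Fin dB) (Fin dB) ℂ := fun k => suppProj ((toMat (x k))ᴴ * toMat (u k))
  let w : ι ⊕ (Fin dA × Fin dB) → Matrix (Fin dA) (Fin dA) ℂ :=
    Sum.elim (fun k => toMat (x k) * Q k * (toMat (x k))ᴴ) 0
  -- Since the blocks `w k` lie below the reduced operators, the trace norm of the difference is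
  -- just a difference of traces, `1 - ∑ Tr (w k)`.
  have hdiff : ∀ k, (toMat (Sum.elim x r k) * (toMat (Sum.elim x r k))ᴴ - w k).PosSemidef := by
    rintro (k | k)
    · have := conj_mono (suppProj_le_one ((toMat (x k))ᴴ * toMat (u k))) (toMat (x k))
      rw [Matrix.mul_one] at this
      exact this
    · simp only [w, Sum.elim_inr, Pi.zero_apply, sub_zero]
      exact posSemidef_self_mul_conjTranspose _
  have hwp : ∀ k, (w k).PosSemidef := by
    rintro (k | k)
    · exact (suppProj_posSemidef ((toMat (x k))ᴴ * toMat (u k))).mul_mul_conjTranspose_same _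
    · exact (PosSemidef.zero : (0 : Matrix (Fin dA) (Fin dA) ℂ).PosSemidef)
  have hwr : ∀ k, (w k).rank ≤ M := by
    rintro (k | k)
    · refine (rank_mul_le_left _ _).trans ((rank_mul_le_right _ _).trans ?_)
      exact (rank_suppProj _).le.trans ((rank_mul_le_right _ _).trans (hur k))
    · simp [w]
  refine ⟨n, p, φ, fun i => w (e i), hdec, fun i => hwp _, fun i => hwr _, ?_⟩
  · rw [reduceRA_cqExtension, ← traceNorm_neg, neg_sub, cqOp_sub]
    simp only [hpφ, reduceA_ketbra]
    rw [traceNorm_of_posSemidef (cqOp_posSemidef fun i => hdiff (e i)), trace_cqOp,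
      Equiv.sum_comp e fun k =>
        (toMat (Sum.elim x r k) * (toMat (Sum.elim x r k))ᴴ - w k).trace]
    simp only [trace_sub, Finset.sum_sub_distrib, ← reduceA_ketbra, trace_reduceA]
    rw [← trace_sum, hsum, hρ.2, Fintype.sum_sum_type, Complex.sub_re, Complex.one_re]
    simp only [w, Sum.elim_inl, Sum.elim_inr, Pi.zero_apply, trace_zero, Finset.sum_const_zero,
      add_zero, Complex.re_sum]
    have hQ : ∀ k, (toMat (u k))ᴴ * (toMat (x k) * Q k) = (toMat (u k))ᴴ * toMat (x k) := by
      intro k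
      have := congrArg conjTranspose (suppProj_mul_self ((toMat (x k))ᴴ * toMat (u k)))
      simpa only [conjTranspose_mul, suppProj_isHermitian, conjTranspose_conjTranspose,
        Matrix.mul_assoc] using this
    have hw : ∀ k, ((toMat (x k) * Q k)ᴴ * (toMat (x k) * Q k)).trace =
        (toMat (x k) * Q k * (toMat (x k))ᴴ).trace := by
      intro k
      rw [trace_mul_comm, conjTranspose_mul, ← Matrix.mul_assoc, Matrix.mul_assoc (toMat (x k)),
        suppProj_isHermitian, suppProj_mul_suppProj]
    have hA : ∑ k, ((toMat (u k))ᴴ * toMat (u k)).trace.re = 1 := by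
      simp only [trace_conjTranspose_mul_toMat]
      rw [← Complex.re_sum, hu, Complex.one_re]
    have hVX : (Vᴴ * X).trace.re = ∑ k, ((toMat (u k))ᴴ * (toMat (x k) * Q k)).trace.re := by
      simp only [hQ, trace_conjTranspose_mul_toMat]
      rw [← Complex.re_sum]
      rfl
    -- As `Tr (w k)` is the squared norm of the compressed vector, Cauchy–Schwarz against the
    -- normalised `u` yields `F² ≤ ∑ Tr (w k)`.
    have := sq_sum_re_trace_le (fun k => toMat (u k)) (fun k => toMat (x k) * Q k) hA
    simp only [hw, ← hVX] at this
    linarith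

lemma exists_maxEntangled_vector {M : ℕ} (hM : M ≠ 0) : ∃ ψ : Fin M × Fin M → ℂ,
    maxEntangled M = ketbra ψ ∧ star ψ ⬝ᵥ ψ = 1 ∧ (toMat ψ).rank ≤ M := by
  obtain ⟨ψ, h, hm⟩ := maxEntangled_eq M
  refine ⟨ψ, h, ?_, by simpa using (toMat ψ).rank_le_width⟩
  rw [← trace_conjTranspose_mul_toMat, hm]
  simp only [conjTranspose_smul, conjTranspose_one, Matrix.mul_smul, Matrix.mul_one, smul_smul,
    trace_smul, trace_one, Fintype.card_fin, smul_eq_mul]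
  rw [mul_comm, ← sqrt_inv_mul_star_self hM]

lemma IsLOCC.exists_decomposition_near {ρ : BipMat dA dB} (hρ : IsState ρ) {M : ℕ} (hM : M ≠ 0)
    {Λ : BipMat M M → BipMat dA dB} (hΛ : IsLOCC dA dB M M Λ) :
    ∃ (n : ℕ) (p : Fin n → ℝ) (φ : Fin n → Fin dA × Fin dB → ℂ)
      (w : Fin n → Matrix (Fin dA) (Fin dA) ℂ), IsDecomposition ρ p φ ∧
      (∀ i, (w i).PosSemidef) ∧ (∀ i, (w i).rank ≤ M) ∧
      traceNorm (cqOp w - reduceRA (cqExtension p φ)) ≤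
        1 - fidelity (Λ (maxEntangled M)) ρ ^ 2 := by
  obtain ⟨ψ, hψ, hψ1, hψr⟩ := exists_maxEntangled_vector hM
  obtain ⟨ι, _, u, hu, hur, hun⟩ := hΛ.exists_ensemble M ψ hψr
  rw [hψ, hu]
  exact OneShotDilution.exists_decomposition_near hρ u hur (hun.trans hψ1)

/-- `1 - F²` dominates a trace norm, hence is nonnegative. This bounds the set whose real supremum
defines `dilutionFidelity`. -/
lemma IsLOCC.fidelity_sq_le_one {ρ : BipMat dA dB} (hρ : IsState ρ) {M : ℕ} (hM : M ≠ 0)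
    {Λ : BipMat M M → BipMat dA dB} (hΛ : IsLOCC dA dB M M Λ) :
    fidelity (Λ (maxEntangled M)) ρ ^ 2 ≤ 1 := by
  obtain ⟨n, p, φ, w, -, -, -, h⟩ := hΛ.exists_decomposition_near hρ hM
  linarith [traceNorm_nonneg (cqOp w - reduceRA (cqExtension p φ))]

lemma IsLOCC.le_dilutionFidelity {ρ : BipMat dA dB} (hρ : IsState ρ) {M : ℕ} (hM : M ≠ 0)
    {Λ : BipMat M M → BipMat dA dB} (hΛ : IsLOCC dA dB M M Λ) :
    fidelity (Λ (maxEntangled M)) ρ ^ 2 ≤ dilutionFidelity ρ M :=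
  le_csSup ⟨1, by rintro _ ⟨Λ, hΛ, rfl⟩; exact hΛ.fidelity_sq_le_one hρ hM⟩ ⟨Λ, hΛ, rfl⟩

end Converse

/-! ### From a nearby c-q operator to a protocol -/

section Achievability

variable {dA dB : ℕ}

/-- A unit vector has a good approximation by a unit vector supported in the range of a given
operator of rank at most `M` on the first factor. -/
lemma exists_unit_near {M : ℕ} (hM : M ≠ 0) (φ : Fin dA × Fin dB → ℂ) (hφ : star φ ⬝ᵥ φ = 1)
    (w : Matrix (Fin dA) (Fin dA) ℂ) (hw : w.rank ≤ M) :
    ∃ ψ : Fin dA × Fin dB → ℂ, star ψ ⬝ᵥ ψ = 1 ∧ (toMat ψ).rank ≤ M ∧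
      (suppProj w * reduceA (ketbra φ)).trace.re ≤ (star ψ ⬝ᵥ φ).re := by
  have hne : Nonempty (Fin dA × Fin dB) := by
    by_contra h
    rw [not_nonempty_iff] at h
    simp [dotProduct] at hφ
  set P := suppProj w with hP
  have hPh : Pᴴ = P := suppProj_isHermitian w
  set v : Fin dA × Fin dB → ℂ := (P ⊗ₖ (1 : Matrix (Fin dB) (Fin dB) ℂ)) *ᵥ φ with hv
  have hvm : toMat v = P * toMat φ := by
    rw [hv, toMat_kronecker_mulVec, transpose_one, Matrix.mul_one]
  have e1 : (P * reduceA (ketbra φ)).trace = star v ⬝ᵥ φ := by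
    rw [← trace_conjTranspose_mul_toMat, hvm, reduceA_ketbra, conjTranspose_mul, hPh,
      ← Matrix.mul_assoc, trace_mul_comm, Matrix.mul_assoc]
  have e2 : star v ⬝ᵥ v = star v ⬝ᵥ φ := by
    rw [← trace_conjTranspose_mul_toMat, ← trace_conjTranspose_mul_toMat, hvm, conjTranspose_mul,
      hPh, Matrix.mul_assoc, ← Matrix.mul_assoc P, suppProj_mul_suppProj, Matrix.mul_assoc]
  rw [e1, ← e2]
  have hn : 0 ≤ star v ⬝ᵥ v := dotProduct_star_self_nonneg _
  set c := (star v ⬝ᵥ v).re with hc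
  have hc0 : 0 ≤ c := (Complex.le_def.1 hn).1
  have hcc : (c : ℂ) = star v ⬝ᵥ v :=
    Complex.ext rfl (by simpa using (Complex.le_def.1 hn).2)
  -- Here `c = ‖Pφ‖²`. If `c = 0`, a product basis vector with suitable sign has nonnegative overlap
  -- with `φ`. Otherwise `v / √c` has overlap `√c`, which is at least `c` because `c ≤ 1`.
  rcases hc0.eq_or_lt with h0 | hpos
  · rw [← h0]
    obtain ⟨y⟩ := hne
    have hr : ∀ z : ℂ, (toMat (Pi.single y z : Fin dA × Fin dB → ℂ)).rank ≤ M := by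
      intro z
      have : toMat (Pi.single y z : Fin dA × Fin dB → ℂ) =
          vecMulVec (Pi.single y.1 z) (Pi.single y.2 1) := by
        ext i j
        by_cases hi : i = y.1 <;> by_cases hj : j = y.2 <;>
          simp [toMat, vecMulVec_apply, Pi.single_apply, Prod.ext_iff, hi, hj]
      rw [this]
      exact (rank_vecMulVec_le _ _).trans (Nat.one_le_iff_ne_zero.2 hM)
    rcases le_total 0 (φ y).re with h | h
    · exact ⟨Pi.single y 1, by simp, hr 1, by simpa using h⟩
    · exact ⟨Pi.single y (-1), by simp, hr _, by
        simpa [← Pi.single_star] using h⟩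
  · have hc1 : c ≤ 1 := by
      have h := trace_re_mono (conj_mono' (suppProj_le_one w) (toMat φ))
      rw [Matrix.mul_one, trace_conjTranspose_mul_toMat, hφ, Complex.one_re, ← hP,
        Matrix.mul_assoc, ← hvm, trace_conjTranspose_mul_toMat] at h
      have h2 : star φ ⬝ᵥ v = star (star v ⬝ᵥ φ) := star_dotProduct φ v
      rw [h2, ← e2, ← hcc] at h
      simpa using h
    have hs : Real.sqrt c ≠ 0 := (Real.sqrt_pos.2 hpos).ne'
    refine ⟨(((Real.sqrt c)⁻¹ : ℝ) : ℂ) • v, ?_, ?_, ?_⟩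
    · rw [star_smul, smul_dotProduct, dotProduct_smul, smul_smul, Complex.star_def,
        Complex.conj_ofReal, ← hcc, smul_eq_mul, ← Complex.ofReal_mul, ← Complex.ofReal_mul,
        ← mul_inv, Real.mul_self_sqrt hc0, inv_mul_cancel₀ hpos.ne', Complex.ofReal_one]
    · rw [toMat_smul, hvm, ← Matrix.mul_smul]
      refine (rank_mul_le_left _ _).trans ?_
      rw [hP, rank_suppProj]
      exact hw
    · rw [star_smul, smul_dotProduct, ← e2, ← hcc, Complex.star_def, Complex.conj_ofReal,
        smul_eq_mul, ← Complex.ofReal_mul, Complex.ofReal_re]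
      have : (Real.sqrt c)⁻¹ * c = Real.sqrt c := by
        nth_rewrite 2 [← Real.mul_self_sqrt hc0]
        rw [← mul_assoc, inv_mul_cancel₀ hs, one_mul]
      rw [this]
      exact Real.le_sqrt_of_sq_le (by nlinarith)

/-- A c-q operator with blocks of rank at most `M` close to a decomposition of `ρ` yields a
dilution protocol of high fidelity. -/
lemma exists_isLOCC_fidelity_ge {ρ : BipMat dA dB} {n M : ℕ} (hM : M ≠ 0) {p : Fin n → ℝ}
    {φ : Fin n → Fin dA × Fin dB → ℂ} (hdec : IsDecomposition ρ p φ)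
    {w : Fin n → Matrix (Fin dA) (Fin dA) ℂ} (hw : ∀ i, (w i).PosSemidef)
    (hr : ∀ i, (w i).rank ≤ M) :
    ∃ Λ : BipMat M M → BipMat dA dB, IsLOCC dA dB M M Λ ∧
      1 - traceNorm (cqOp w - reduceRA (cqExtension p φ)) ≤ fidelity (Λ (maxEntangled M)) ρ := by
  obtain ⟨hp, hp1, hφ, hρ⟩ := hdec
  choose ψ hψ hψr hov using fun i => exists_unit_near hM (φ i) (hφ i) (w i) (hr i)
  obtain ⟨Λ, hΛ, hΛψ⟩ := exists_isLOCC_prepare_mixture hM p hp hp1 ψ hψ hψr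
  refine ⟨Λ, hΛ, ?_⟩
  -- The two mixtures are written as `V Vᴴ` with columns `√(p i) v i`, so the overlap in Uhlmann's
  -- bound is the `p`-average of the overlaps.
  have hmix : ∀ v : Fin n → Fin dA × Fin dB → ℂ, ∑ i, (p i : ℂ) • ketbra (v i) =
      (of fun y i => ((Real.sqrt (p i) : ℝ) : ℂ) * v i y) *
        (of fun y i => ((Real.sqrt (p i) : ℝ) : ℂ) * v i y)ᴴ := by
    intro v
    rw [← sum_ketbra_columns]
    refine Finset.sum_congr rfl fun i _ => ?_
    have : (fun y => (of fun y i => ((Real.sqrt (p i) : ℝ) : ℂ) * v i y) y i) =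
        ((Real.sqrt (p i) : ℝ) : ℂ) • v i := rfl
    rw [this, ketbra_smul, Complex.star_def, Complex.conj_ofReal, ← Complex.ofReal_mul,
      Real.mul_self_sqrt (hp i)]
  have hF := re_trace_le_fidelity (of fun y i => ((Real.sqrt (p i) : ℝ) : ℂ) * ψ i y)
    (of fun y i => ((Real.sqrt (p i) : ℝ) : ℂ) * φ i y)
  rw [← hmix, ← hmix, hρ, ← hΛψ] at hF
  refine le_trans ?_ hF
  have hov' : ((of fun y i => ((Real.sqrt (p i) : ℝ) : ℂ) * ψ i y)ᴴ *
      (of fun y i => ((Real.sqrt (p i) : ℝ) : ℂ) * φ i y)).trace.re =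
        ∑ i, p i * (star (ψ i) ⬝ᵥ φ i).re := by
    rw [trace, Complex.re_sum]
    refine Finset.sum_congr rfl fun i _ => ?_
    have : ((of fun y i => ((Real.sqrt (p i) : ℝ) : ℂ) * ψ i y)ᴴ *
        (of fun y i => ((Real.sqrt (p i) : ℝ) : ℂ) * φ i y)).diag i =
        star (((Real.sqrt (p i) : ℝ) : ℂ) • ψ i) ⬝ᵥ (((Real.sqrt (p i) : ℝ) : ℂ) • φ i) := rfl
    rw [this, star_smul, smul_dotProduct, dotProduct_smul, smul_smul, Complex.star_def,
      Complex.conj_ofReal, ← Complex.ofReal_mul, Real.mul_self_sqrt (hp i), smul_eq_mul,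
      Complex.re_ofReal_mul]
  rw [hov']
  refine le_trans ?_ (Finset.sum_le_sum fun i _ => mul_le_mul_of_nonneg_left (hov i) (hp i))
  set r : Fin n → Matrix (Fin dA) (Fin dA) ℂ := fun i => reduceA ((p i : ℂ) • ketbra (φ i)) with hr'
  have hrp : ∀ i, (r i).PosSemidef := fun i => reduceA_smul_ketbra_posSemidef (hp i) _
  rw [reduceRA_cqExtension, ← hr', ← traceNorm_neg, neg_sub]
  -- The effect `1 - Π` annihilates `cqOp w`, so its expectation on the difference is the weight of
  -- `ρ_RA` outside the support of `w`; by duality this is at most the trace norm.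
  have hQ : (1 - suppProj (cqOp w)).PosSemidef := le_iff.1 (suppProj_le_one _)
  have hQ1 : 1 - suppProj (cqOp w) ≤ 1 := by
    rw [sub_le_self_iff]
    exact (suppProj_posSemidef _).nonneg
  have hH : (cqOp r - cqOp w)ᴴ = cqOp r - cqOp w := by
    rw [conjTranspose_sub, (cqOp_posSemidef hw).isHermitian.eq,
      (cqOp_posSemidef hrp).isHermitian.eq]
  have hd := re_trace_mul_le_traceNorm hH hQ hQ1
  have hcalc : ((1 - suppProj (cqOp w)) * (cqOp r - cqOp w)).trace.re =
      1 - ∑ i, p i * (suppProj (w i) * reduceA (ketbra (φ i))).trace.re := by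
    rw [Matrix.mul_sub, Matrix.sub_mul _ _ (cqOp w), Matrix.one_mul, suppProj_mul_self, sub_self,
      sub_zero, Matrix.sub_mul, Matrix.one_mul, suppProj_cqOp, cqOp_mul, trace_sub, trace_cqOp,
      trace_cqOp, Complex.sub_re]
    simp only [hr', reduceA_smul, Matrix.mul_smul, trace_smul, trace_reduceA, trace_ketbra, hφ,
      Complex.re_sum, smul_eq_mul, mul_one, Complex.ofReal_re, hp1, Complex.re_ofReal_mul]
  linarith

end Achievability

/-! ### Compactness for exact dilution -/

section ExactDilution

/-- In finite dimension the convex hull of a compact set is compact. -/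
lemma isCompact_convexHull_of_finiteDimensional {E : Type} [AddCommGroup E] [Module ℝ E]
    [TopologicalSpace E] [IsTopologicalAddGroup E] [ContinuousSMul ℝ E] [FiniteDimensional ℝ E]
    {s : Set E} (hs : IsCompact s) : IsCompact (convexHull ℝ s) := by
  rcases s.eq_empty_or_nonempty with rfl | ⟨z₀, hz₀⟩
  · simp
  -- Carathéodory: `dim + 1` points suffice, and shorter combinations are padded with weight 0 at
  -- `z₀`. The hull is then a continuous image of simplex times `s ^ N`.
  let N := Module.finrank ℝ E + 1
  let f : (Fin N → ℝ) × (Fin N → E) → E := fun x => ∑ i, x.1 i • x.2 i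
  have hf : Continuous f := by fun_prop
  have hK : IsCompact (stdSimplex ℝ (Fin N) ×ˢ (Set.univ.pi fun _ : Fin N => s)) :=
    (isCompact_stdSimplex ℝ (Fin N)).prod (isCompact_univ_pi fun _ => hs)
  convert hK.image hf using 1
  apply Set.Subset.antisymm
  · intro x hx
    obtain ⟨ι, _, z, w, hz, hi, hw, hw1, rfl⟩ := eq_pos_convex_span_of_mem_convexHull hx
    have hcard : Fintype.card ι ≤ Fintype.card (Fin N) := by
      rw [Fintype.card_fin]
      exact hi.card_le_finrank_succ.trans (Nat.succ_le_succ (Submodule.finrank_le _))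
    obtain ⟨g⟩ := Function.Embedding.nonempty_of_card_le hcard
    refine ⟨(Function.extend g w 0, Function.extend g z fun _ => z₀), ⟨⟨?_, ?_⟩, ?_⟩, ?_⟩
    · intro j
      by_cases hj : ∃ i, g i = j
      · obtain ⟨i, rfl⟩ := hj
        simpa [g.injective.extend_apply] using (hw i).le
      · simp [Function.extend_apply' _ _ _ hj]
    · rw [← hw1]
      symm
      refine Fintype.sum_of_injective g g.injective _ _ (fun j hj => ?_) fun i => ?_
      · simp [Function.extend_apply' _ _ _ hj]
      · simp [g.injective.extend_apply]
    · intro j _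
      by_cases hj : ∃ i, g i = j
      · obtain ⟨i, rfl⟩ := hj
        simpa [g.injective.extend_apply] using hz (Set.mem_range_self i)
      · simpa [Function.extend_apply' _ _ _ hj] using hz₀
    · symm
      refine Fintype.sum_of_injective g g.injective _ _ (fun j hj => ?_) fun i => ?_
      · simp [Function.extend_apply' _ _ _ hj]
      · simp [g.injective.extend_apply]
  · rintro _ ⟨⟨w, z⟩, ⟨⟨hw, hw1⟩, hz⟩, rfl⟩
    exact (convex_convexHull ℝ s).sum_mem (fun i _ => hw i) hw1
      fun i _ => subset_convexHull ℝ s (hz i (Set.mem_univ i))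

variable {dA dB : ℕ}

lemma rank_smul_le {a b : ℕ} (c : ℂ) (A : Matrix (Fin a) (Fin b) ℂ) : (c • A).rank ≤ A.rank := by
  have : c • A = A * (c • (1 : Matrix (Fin b) (Fin b) ℂ)) := by
    rw [Matrix.mul_smul, Matrix.mul_one]
  rw [this]
  exact rank_mul_le_left _ _

lemma rank_smul_eq {a b : ℕ} {c : ℂ} (hc : c ≠ 0) (A : Matrix (Fin a) (Fin b) ℂ) :
    (c • A).rank = A.rank := by
  refine le_antisymm (rank_smul_le c A) ?_
  have := rank_smul_le c⁻¹ (c • A)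
  rwa [smul_smul, inv_mul_cancel₀ hc, one_smul] at this

lemma norm_apply_le_one_of_conjTranspose_mul_self {a b : ℕ} (G : Matrix (Fin a) (Fin b) ℂ) (j : Fin b)
    (h : ((Gᴴ * G) j j).re ≤ 1) (i : Fin a) : ‖G i j‖ ≤ 1 := by
  have h1 : ((Gᴴ * G) j j).re = ∑ i, ‖G i j‖ ^ 2 := by
    rw [mul_apply, Complex.re_sum]
    refine Finset.sum_congr rfl fun i _ => ?_
    rw [conjTranspose_apply, Complex.star_def, ← Complex.normSq_eq_conj_mul_self,
      Complex.normSq_eq_norm_sq, Complex.ofReal_re]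
  have h2 : ‖G i j‖ ^ 2 ≤ ∑ i, ‖G i j‖ ^ 2 :=
    Finset.single_le_sum (f := fun i => ‖G i j‖ ^ 2) (fun i _ => sq_nonneg _) (Finset.mem_univ i)
  rw [h1] at h
  nlinarith [norm_nonneg (G i j)]

/-- The projectors onto unit vectors of Schmidt rank at most `M` lie in a compact set of
rank-one operators of such vectors. -/
lemma exists_isCompact_ketbra (dA dB M : ℕ) : ∃ K : Set (BipMat dA dB), IsCompact K ∧
    (∀ v : Fin dA × Fin dB → ℂ, (toMat v).rank ≤ M → star v ⬝ᵥ v = 1 → ketbra v ∈ K) ∧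
    ∀ τ ∈ K, ∃ v : Fin dA × Fin dB → ℂ, (toMat v).rank ≤ M ∧ τ = ketbra v := by
  let B : (a b : ℕ) → Set (Matrix (Fin a) (Fin b) ℂ) := fun a b =>
    Set.univ.pi fun _ => Set.univ.pi fun _ => Metric.closedBall 0 1
  have hB : ∀ a b, IsCompact (B a b) := fun a b =>
    isCompact_univ_pi fun _ => isCompact_univ_pi fun _ => isCompact_closedBall _ _
  -- Rank at most `M` is encoded by a factorisation through `ℂ^M`, and the Schmidt factors of a unit
  -- vector have entries of modulus at most 1. The image also contains projectors of non-unit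
  -- vectors, which does no harm since ensembles are renormalised later.
  let f : Matrix (Fin dA) (Fin M) ℂ × Matrix (Fin M) (Fin dB) ℂ → BipMat dA dB := fun x =>
    ketbra fun y => (x.1 * x.2) y.1 y.2
  have hf : Continuous f := by
    refine continuous_matrix fun y z => ?_
    simp only [f, ketbra, vecMulVec_apply, Pi.star_apply]
    fun_prop
  refine ⟨f '' (B dA M ×ˢ B M dB), ((hB _ _).prod (hB _ _)).image hf, fun v hr hv => ?_, ?_⟩
  · obtain ⟨G, W, ν, s, hGW, hG, hW, hs⟩ := exists_schmidt_factorization (toMat v) hr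
    classical
    have hν : ∀ j, ((Gᴴ * G) j j).re ≤ 1 := by
      have h1 : ((toMat v)ᴴ * toMat v).trace = ∑ j, (Gᴴ * G) j j := by
        rw [← hGW, conjTranspose_mul, Matrix.mul_assoc, ← Matrix.mul_assoc Gᴴ, hG, trace_mul_comm,
          Matrix.mul_assoc, hW, diagonal_mul_diagonal, trace_diagonal]
        refine Finset.sum_congr rfl fun j _ => ?_
        by_cases hj : j ∈ s
        · simp [hj]
        · rw [← hG, mul_apply]
          simp [hj, hs j hj]
      rw [trace_conjTranspose_mul_toMat, hv] at h1
      intro j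
      have h2 := congrArg Complex.re h1
      rw [Complex.one_re, Complex.re_sum] at h2
      rw [h2]
      exact Finset.single_le_sum (f := fun j => ((Gᴴ * G) j j).re) (fun i _ =>
        (Complex.le_def.1 (posSemidef_conjTranspose_mul_self G).diag_nonneg).1) (Finset.mem_univ j)
    refine ⟨(G, W), ⟨fun i _ j _ => ?_, fun j _ y _ => ?_⟩, ?_⟩
    · rw [mem_closedBall_zero_iff]
      exact norm_apply_le_one_of_conjTranspose_mul_self G j (hν j) i
    · rw [mem_closedBall_zero_iff]
      have h := norm_apply_le_one_of_conjTranspose_mul_self Wᴴ j (by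
        rw [conjTranspose_conjTranspose, hW, diagonal_apply_eq]
        by_cases hj : j ∈ s <;> simp [hj]) y
      simpa using h
    · simp only [f, hGW]
      rfl
  · rintro _ ⟨⟨G, W⟩, -, rfl⟩
    refine ⟨_, ?_, rfl⟩
    have : toMat (fun y : Fin dA × Fin dB => (G * W) y.1 y.2) = G * W := rfl
    rw [this]
    exact (rank_mul_le_right _ _).trans (by simpa using W.rank_le_height)

attribute [local instance] Matrix.frobeniusNormedAddCommGroup

lemma frobenius_norm_sq_eq {α ι : Type} [Fintype α] [Fintype ι] (A : Matrix α ι ℂ) :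
    ‖A‖ ^ 2 = (Aᴴ * A).trace.re := by
  rw [frobenius_norm_def, ← Real.sqrt_eq_rpow, Real.sq_sqrt (by positivity), trace,
    Complex.re_sum, Finset.sum_comm]
  refine Finset.sum_congr rfl fun j _ => ?_
  rw [diag_apply, mul_apply, Complex.re_sum]
  refine Finset.sum_congr rfl fun i _ => ?_
  rw [conjTranspose_apply, Complex.star_def, ← Complex.normSq_eq_conj_mul_self,
    Complex.normSq_eq_norm_sq, Complex.ofReal_re, Real.rpow_two]

/-- States of fidelity close to one are close. -/
lemma norm_sub_le_of_fidelity {α ι : Type} [Fintype α] [DecidableEq α] [Fintype ι]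
    (V : Matrix α ι ℂ) (hV : (Vᴴ * V).trace.re = 1) {ρ : Matrix α α ℂ} (hρ : IsState ρ) {t : ℝ}
    (ht : 0 ≤ t) (hF : 2 - 2 * fidelity (V * Vᴴ) ρ ≤ t ^ 2) : ‖V * Vᴴ - ρ‖ ≤ 2 * t + t ^ 2 := by
  obtain ⟨X, hX, hXF⟩ := exists_re_trace_eq_fidelity V hρ.1
  rw [← hXF] at hF
  have hR := le_iff.1 hX
  have hXtr : (Xᴴ * X).trace.re + (ρ - X * Xᴴ).trace.re = 1 := by
    rw [trace_sub, Complex.sub_re, hρ.2, trace_mul_comm]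
    simp
  have hRn : 0 ≤ (ρ - X * Xᴴ).trace.re := (Complex.le_def.1 hR.trace_nonneg).1
  -- With `hXtr` this gives `‖V - X‖² + Tr (ρ - X Xᴴ) = 2 - 2F ≤ t²`, so both nonnegative terms are
  -- at most `t²`.
  have hd : ‖V - X‖ ^ 2 = 1 + (Xᴴ * X).trace.re - 2 * (Vᴴ * X).trace.re := by
    have hc : (Xᴴ * V).trace.re = (Vᴴ * X).trace.re := by
      have : Xᴴ * V = (Vᴴ * X)ᴴ := by simp
      rw [this, trace_conjTranspose]
      simp
    rw [frobenius_norm_sq_eq]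
    simp only [conjTranspose_sub, Matrix.sub_mul, Matrix.mul_sub, trace_sub, Complex.sub_re, hc, hV]
    ring
  have hVn : ‖V‖ ≤ 1 := by
    have := frobenius_norm_sq_eq V
    nlinarith [norm_nonneg V]
  have hXn : ‖X‖ ≤ 1 := by
    have := frobenius_norm_sq_eq X
    nlinarith [norm_nonneg X]
  have hdt : ‖V - X‖ ≤ t := by
    refine abs_le_of_sq_le_sq' ?_ ht |>.2
    linarith
  have h1 : ‖V * Vᴴ - X * Xᴴ‖ ≤ 2 * t := by
    have e : V * Vᴴ - X * Xᴴ = V * (V - X)ᴴ + (V - X) * Xᴴ := by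
      rw [conjTranspose_sub, Matrix.mul_sub, Matrix.sub_mul]
      abel
    rw [e]
    refine (norm_add_le _ _).trans ?_
    have ha := frobenius_norm_mul V (V - X)ᴴ
    have hb := frobenius_norm_mul (V - X) Xᴴ
    rw [frobenius_norm_conjTranspose] at ha hb
    nlinarith [norm_nonneg V, norm_nonneg X, norm_nonneg (V - X)]
  have h2 : ‖X * Xᴴ - ρ‖ ≤ t ^ 2 := by
    set S := CFC.sqrt (ρ - X * Xᴴ) with hS
    have hSS : S * Sᴴ = ρ - X * Xᴴ := by
      rw [hS, sqrt_isHermitian, sqrt_mul_sqrt hR]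
    have h := frobenius_norm_mul S Sᴴ
    rw [frobenius_norm_conjTranspose, ← sq, frobenius_norm_sq_eq, trace_mul_comm, hSS] at h
    rw [norm_sub_rev]
    refine h.trans ?_
    nlinarith [sq_nonneg ‖V - X‖]
  calc ‖V * Vᴴ - ρ‖ = ‖(V * Vᴴ - X * Xᴴ) + (X * Xᴴ - ρ)‖ := by congr 1; abel
    _ ≤ _ := (norm_add_le _ _).trans (add_le_add h1 h2)

/-- If dilution from the maximally entangled state of rank `M` is possible with fidelity
arbitrarily close to one, then `ρ` is a mixture of vectors of Schmidt rank at most `M`. -/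
lemma exists_decomposition_rank_le {ρ : BipMat dA dB} (hρ : IsState ρ) {M : ℕ} (hM : M ≠ 0)
    (h : 1 ≤ dilutionFidelity ρ M) :
    ∃ (n : ℕ) (p : Fin n → ℝ) (φ : Fin n → Fin dA × Fin dB → ℂ), IsDecomposition ρ p φ ∧
      ∀ i, (reduceA ((p i : ℂ) • ketbra (φ i))).rank ≤ M := by
  obtain ⟨K, hK, hKmem, hKrank⟩ := exists_isCompact_ketbra dA dB M
  -- A supremum equal to one need not be attained by a protocol, so `ρ` is first only a limit of
  -- mixtures from `K`; the hull being closed puts `ρ` in it.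
  have hmem : ρ ∈ convexHull ℝ K := by
    have hcl : IsClosed (convexHull ℝ K) :=
      (isCompact_convexHull_of_finiteDimensional hK).isClosed
    rw [← hcl.closure_eq]
    refine Metric.mem_closure_iff.2 fun ε hε => ?_
    -- Then `2t + t² ≤ 3t < ε`. A protocol with `F² > 1 - t²/2` has `F ≥ F²` because `F ≤ 1`, hence
    -- `2 - 2F ≤ t²`.
    set t := min 1 (ε / 4) with ht
    have ht0 : 0 < t := lt_min one_pos (by linarith)
    have ht1 : t ≤ 1 := min_le_left _ _
    have ht2 : t ≤ ε / 4 := min_le_right _ _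
    have hlt : 1 - t ^ 2 / 2 < dilutionFidelity ρ M := by nlinarith
    have hne : {f : ℝ | ∃ Λ : BipMat M M → BipMat dA dB, IsLOCC dA dB M M Λ ∧
        f = fidelity (Λ (maxEntangled M)) ρ ^ 2}.Nonempty := by
      by_contra hempty
      rw [Set.not_nonempty_iff_eq_empty] at hempty
      rw [dilutionFidelity, hempty, Real.sSup_empty] at h
      linarith
    obtain ⟨_, ⟨Λ, hΛ, rfl⟩, hΛt⟩ := exists_lt_of_lt_csSup hne hlt
    obtain ⟨ψ, hψ, hψ1, hψr⟩ := exists_maxEntangled_vector hM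
    obtain ⟨ι, _, u, hu, hur, hun⟩ := hΛ.exists_ensemble M ψ hψr
    have hF1 := hΛ.fidelity_sq_le_one hρ hM
    have hF0 := fidelity_nonneg (Λ (maxEntangled M)) ρ
    rw [hψ, hu] at hΛt hF1 hF0
    have hσ : IsState (∑ k, ketbra (u k)) := by
      refine ⟨posSemidef_sum _ fun k _ => ketbra_posSemidef _, ?_⟩
      rw [trace_sum]
      simp only [trace_ketbra, hun, hψ1]
    refine ⟨∑ k, ketbra (u k), ?_, ?_⟩
    · obtain ⟨n, e, p, φ, ⟨hp, hp1, hφ, hs⟩, hpe⟩ := exists_isDecomposition hσ u rfl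
      rw [← hs]
      have hterm : ∀ i, p i ≠ 0 → ketbra (φ i) ∈ K := by
        intro i hi
        refine hKmem _ ?_ (hφ i)
        have hr := congrArg (fun τ => (reduceA τ).rank) (hpe i)
        simp only [reduceA_smul, reduceA_ketbra] at hr
        rw [rank_smul_eq (Complex.ofReal_ne_zero.2 hi), rank_self_mul_conjTranspose,
          rank_self_mul_conjTranspose] at hr
        rw [hr]
        exact hur _
      obtain ⟨i₀, hi₀⟩ : ∃ i, p i ≠ 0 := by
        by_contra! hall
        simp [hall] at hp1
      -- The rank of `φ i` is controlled only when `p i ≠ 0`; the other vectors carry no weight and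
      -- are replaced by `φ i₀`.
      refine mem_convexHull_of_exists_fintype p
        (fun i => if p i = 0 then ketbra (φ i₀) else ketbra (φ i)) hp hp1 (fun i => ?_) ?_
      · split_ifs with hi
        · exact hterm _ hi₀
        · exact hterm _ hi
      · refine Finset.sum_congr rfl fun i _ => ?_
        split_ifs with hi
        · simp [hi]
        · rfl
    · rw [dist_eq_norm, norm_sub_rev, sum_ketbra_eq]
      rw [sum_ketbra_eq] at hΛt hF1 hF0
      refine (norm_sub_le_of_fidelity _ ?_ hρ ht0.le ?_).trans_lt ?_
      · rw [trace_mul_comm, ← sum_ketbra_eq, hσ.2, Complex.one_re]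
      · nlinarith
      · nlinarith
  obtain ⟨ι, _, w, z, hw, hw1, hz, hsum⟩ := mem_convexHull_iff_exists_fintype.1 hmem
  choose v hv hzv using fun i => hKrank (z i) (hz i)
  have hx : ∑ i, ketbra (((Real.sqrt (w i) : ℝ) : ℂ) • v i) = ρ := by
    rw [← hsum]
    refine Finset.sum_congr rfl fun i _ => ?_
    rw [ketbra_smul, hzv i, Complex.star_def, Complex.conj_ofReal, ← Complex.ofReal_mul,
      Real.mul_self_sqrt (hw i)]
    rfl
  obtain ⟨n, e, p, φ, hdec, hpe⟩ := exists_isDecomposition hρ _ hx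
  refine ⟨n, p, φ, hdec, fun i => ?_⟩
  rw [hpe, reduceA_ketbra, rank_self_mul_conjTranspose, toMat_smul]
  exact (rank_smul_le _ _).trans (hv _)

end ExactDilution

/-! ### The cost, its two bounds and the exact case -/

section Cost

variable {dA dB : ℕ}

lemma IsState.pos_left {ρ : BipMat dA dB} (hρ : IsState ρ) : dA ≠ 0 := by
  rintro rfl
  simpa [trace] using hρ.2

lemma eq_zero_of_rank_eq_zero {d : ℕ} {A : Matrix (Fin d) (Fin d) ℂ} (h : A.rank = 0) : A = 0 := by
  rw [rank_eq_finrank_range_toLin A (Pi.basisFun ℂ _) (Pi.basisFun ℂ _), Submodule.finrank_eq_zero,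
    LinearMap.range_eq_bot] at h
  exact (toLin _ _).map_eq_zero_iff.1 h

lemma mem_cqBall_self {n : ℕ} {ρ : BipMat dA dB} {p : Fin n → ℝ}
    {φ : Fin n → Fin dA × Fin dB → ℂ} (hdec : IsDecomposition ρ p φ) {δ : ℝ} (hδ : 0 ≤ δ) :
    reduceRA (cqExtension p φ) ∈ cqBall δ (reduceRA (cqExtension p φ)) := by
  refine ⟨?_, ⟨_, reduceRA_cqExtension p φ⟩, ?_⟩
  · rw [reduceRA_cqExtension]
    exact cqOp_posSemidef fun i => reduceA_smul_ketbra_posSemidef (hdec.1 i) _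
  · simpa [traceNorm] using hδ

/-- The smoothed entropy is attained, and it is the logarithm of an integer. -/
lemma exists_smoothCondEntropyZero_eq {n : ℕ} {ρ : BipMat dA dB} {p : Fin n → ℝ}
    {φ : Fin n → Fin dA × Fin dB → ℂ} (hdec : IsDecomposition ρ p φ) {δ : ℝ} (hδ : 0 ≤ δ) :
    ∃ M ≤ dA, ∃ w : Fin n → Matrix (Fin dA) (Fin dA) ℂ,
      cqOp w ∈ cqBall δ (reduceRA (cqExtension p φ)) ∧ condEntropyZero (cqOp w) = logTwo (M : ℕ) ∧
      smoothCondEntropyZero δ (reduceRA (cqExtension p φ)) = logTwo (M : ℕ) := by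
  set ball := cqBall δ (reduceRA (cqExtension p φ)) with hball
  have himg : condEntropyZero '' ball ⊆ (fun M : ℕ => logTwo M) '' Set.Iic dA := by
    rintro _ ⟨_, ⟨-, ⟨w, rfl⟩, -⟩, rfl⟩
    obtain ⟨M, hM, h⟩ := exists_condEntropyZero_cqOp_eq w
    exact ⟨M, hM, h.symm⟩
  have hfin : (condEntropyZero '' ball).Finite := ((Set.finite_Iic dA).image _).subset himg
  have hne : (condEntropyZero '' ball).Nonempty := ⟨_, _, mem_cqBall_self hdec hδ, rfl⟩
  have hs : smoothCondEntropyZero δ (reduceRA (cqExtension p φ)) = sInf (condEntropyZero '' ball) :=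
    sInf_image.symm
  obtain ⟨ω, hω, hωeq⟩ := hne.csInf_mem hfin
  obtain ⟨w, rfl⟩ := hω.2.1
  obtain ⟨M, hM, h⟩ := exists_condEntropyZero_cqOp_eq w
  exact ⟨M, hM, w, hω, h, by rw [hs, ← hωeq, h]⟩

lemma exists_isLeast_smoothEntropyValues {ρ : BipMat dA dB} (hρ : IsState ρ) {δ : ℝ}
    (hδ : 0 ≤ δ) : ∃ x, IsLeast (smoothEntropyValues ρ δ) x := by
  have hsub : smoothEntropyValues ρ δ ⊆ (fun M : ℕ => logTwo M) '' Set.Iic dA := by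
    rintro _ ⟨n, _, ⟨p, φ, hdec, rfl⟩, rfl⟩
    obtain ⟨M, hM, -, -, -, h⟩ := exists_smoothCondEntropyZero_eq hdec hδ
    exact ⟨M, hM, h.symm⟩
  have hfin : (smoothEntropyValues ρ δ).Finite := ((Set.finite_Iic dA).image _).subset hsub
  obtain ⟨n, p, φ, hdec⟩ := exists_isDecomposition_of_isState hρ
  have hne : (smoothEntropyValues ρ δ).Nonempty := ⟨_, n, _, ⟨p, φ, hdec, rfl⟩, rfl⟩
  exact ⟨_, hne.csInf_mem hfin, fun y hy => sInf_le hy⟩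

lemma smoothCondEntropyZero_le {n : ℕ} {δ : ℝ} {τ : BipMat n dA}
    {w : Fin n → Matrix (Fin dA) (Fin dA) ℂ} (hw : cqOp w ∈ cqBall δ τ) {M : ℕ}
    (hr : ∀ i, (w i).rank ≤ M) : smoothCondEntropyZero δ τ ≤ logTwo M :=
  (iInf₂_le _ hw).trans ((condEntropyZero_cqOp_le_iff w M).2 hr)

/-- The protocol has `F ≥ 1 - δ`, and `(1 - δ)² ≥ 1 - 2δ`; squaring needs `1 - δ ≥ 0`. -/
lemma le_dilutionFidelity_of_near {ρ : BipMat dA dB} (hρ : IsState ρ) {n M : ℕ} (hM : M ≠ 0)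
    {p : Fin n → ℝ} {φ : Fin n → Fin dA × Fin dB → ℂ} (hdec : IsDecomposition ρ p φ)
    {w : Fin n → Matrix (Fin dA) (Fin dA) ℂ} (hr : ∀ i, (w i).rank ≤ M) {δ : ℝ} (hδ : δ ≤ 1)
    (hw : cqOp w ∈ cqBall δ (reduceRA (cqExtension p φ))) :
    1 - 2 * δ ≤ dilutionFidelity ρ M := by
  obtain ⟨Λ, hΛ, hF⟩ := exists_isLOCC_fidelity_ge hM hdec (posSemidef_of_cqOp hw.1) hr
  have h1 : 1 - δ ≤ fidelity (Λ (maxEntangled M)) ρ := by linarith [hw.2.2]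
  refine le_trans ?_ (hΛ.le_dilutionFidelity hρ hM)
  nlinarith [pow_le_pow_left₀ (sub_nonneg.2 hδ) h1 2, sq_nonneg δ]

/-- Any decomposition has blocks of rank at most `dA`, so rank `dA` always suffices. Thus achievable
rates exist for every error. -/
lemma one_le_dilutionFidelity {ρ : BipMat dA dB} (hρ : IsState ρ) : 1 ≤ dilutionFidelity ρ dA := by
  obtain ⟨n, p, φ, hdec⟩ := exists_isDecomposition_of_isState hρ
  have hw := mem_cqBall_self hdec le_rfl
  have hw' : cqOp (fun i => reduceA ((p i : ℂ) • ketbra (φ i))) ∈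
      cqBall 0 (reduceRA (cqExtension p φ)) := by
    rwa [← reduceRA_cqExtension]
  have := le_dilutionFidelity_of_near hρ hρ.pos_left hdec
    (fun i => by simpa using rank_le_width (reduceA ((p i : ℂ) • ketbra (φ i)))) zero_le_one hw'
  linarith

/-- The one-shot cost is the logarithm of the least sufficient Schmidt rank. -/
lemma exists_oneShotCost_eq {ρ : BipMat dA dB} (hρ : IsState ρ) {ε : ℝ} (hε : 0 ≤ ε) :
    ∃ M : ℕ, M ≠ 0 ∧ 1 - ε ≤ dilutionFidelity ρ M ∧ oneShotCost ρ ε = Real.logb 2 M ∧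
      IsLeast {R : ℝ | IsAchievableRate ρ ε R} (oneShotCost ρ ε) ∧
      ∀ M' : ℕ, M' ≠ 0 → 1 - ε ≤ dilutionFidelity ρ M' → M ≤ M' := by
  classical
  have hex : ∃ M : ℕ, M ≠ 0 ∧ 1 - ε ≤ dilutionFidelity ρ M :=
    ⟨dA, hρ.pos_left, by linarith [one_le_dilutionFidelity hρ]⟩
  have hM := Nat.find_spec hex
  have hmin : ∀ M' : ℕ, M' ≠ 0 → 1 - ε ≤ dilutionFidelity ρ M' → Nat.find hex ≤ M' :=
    fun M' h1 h2 => Nat.find_min' hex ⟨h1, h2⟩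
  have hpos : ∀ {M : ℕ}, M ≠ 0 → (1 : ℝ) ≤ M := fun h =>
    Nat.one_le_cast.2 (Nat.one_le_iff_ne_zero.2 h)
  have hleast : IsLeast {R : ℝ | IsAchievableRate ρ ε R} (Real.logb 2 (Nat.find hex)) := by
    refine ⟨⟨Real.logb_nonneg (by norm_num) (hpos hM.1), _, Nat.one_le_iff_ne_zero.2 hM.1, le_rfl,
      hM.2⟩, ?_⟩
    rintro R ⟨-, M', hM', hR, hF⟩
    have h := hmin M' (Nat.one_le_iff_ne_zero.1 hM') hF
    exact (Real.logb_le_logb_of_le (by norm_num) (by linarith [hpos hM.1])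
      (Nat.cast_le.2 h)).trans hR
  have hc : oneShotCost ρ ε = Real.logb 2 (Nat.find hex) := hleast.csInf_eq
  exact ⟨_, hM.1, hM.2, hc, hc ▸ hleast, hmin⟩

lemma coe_logb_eq_logTwo {M : ℕ} (hM : M ≠ 0) : ((Real.logb 2 M : ℝ) : EReal) = logTwo M :=
  (logTwo_of_ne (Nat.cast_ne_zero.2 hM)).symm

lemma trace_reduceRA_cqExtension {n : ℕ} {ρ : BipMat dA dB} {p : Fin n → ℝ}
    {φ : Fin n → Fin dA × Fin dB → ℂ} (hdec : IsDecomposition ρ p φ) :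
    (reduceRA (cqExtension p φ)).trace = 1 := by
  rw [reduceRA_cqExtension, trace_cqOp]
  simp only [trace_reduceA, trace_smul, trace_ketbra, hdec.2.2.1, smul_eq_mul, mul_one]
  exact_mod_cast congrArg Complex.ofReal hdec.2.1

lemma traceNorm_reduceRA_cqExtension {n : ℕ} {ρ : BipMat dA dB} {p : Fin n → ℝ}
    {φ : Fin n → Fin dA × Fin dB → ℂ} (hdec : IsDecomposition ρ p φ) :
    traceNorm (reduceRA (cqExtension p φ)) = 1 := by
  rw [traceNorm_of_posSemidef (mem_cqBall_self hdec le_rfl).1, trace_reduceRA_cqExtension hdec,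
    Complex.one_re]

lemma cqOp_zero {n : ℕ} {α : Type} : cqOp (0 : Fin n → Matrix α α ℂ) = 0 := by
  ext x y
  simp [cqOp_apply]

/-- The cost is at least some value of the smoothed entropy. -/
lemma exists_smoothEntropyValue_le {ρ : BipMat dA dB} (hρ : IsState ρ) {ε : ℝ} (hε : 0 ≤ ε)
    {M : ℕ} (hM : M ≠ 0) (hF : 1 - ε ≤ dilutionFidelity ρ M) :
    ∃ x ∈ smoothEntropyValues ρ (2 * Real.sqrt ε), x ≤ logTwo M := by
  rcases hε.eq_or_lt with rfl | hpos
  -- At `ε = 0` the ball has radius 0, so an exact decomposition from the compactness argument is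
  -- required.
  · obtain ⟨n, p, φ, hdec, hr⟩ := exists_decomposition_rank_le hρ hM (by linarith)
    refine ⟨_, ⟨n, _, ⟨p, φ, hdec, rfl⟩, rfl⟩, ?_⟩
    have hw := mem_cqBall_self hdec (δ := 2 * Real.sqrt 0) (by simp)
    have hw' : cqOp (fun i => reduceA ((p i : ℂ) • ketbra (φ i))) ∈
        cqBall (2 * Real.sqrt 0) (reduceRA (cqExtension p φ)) := by
      rwa [← reduceRA_cqExtension]
    exact smoothCondEntropyZero_le hw' hr
  · have hs : 0 < Real.sqrt ε := Real.sqrt_pos.2 hpos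
    have hss : Real.sqrt ε * Real.sqrt ε = ε := Real.mul_self_sqrt hε
    rcases le_or_gt 1 (2 * Real.sqrt ε) with h1 | h1
    -- Since `ρ_RA` has trace norm 1, the ball contains the zero operator, whose entropy is `⊥`.
    · obtain ⟨n, p, φ, hdec⟩ := exists_isDecomposition_of_isState hρ
      refine ⟨_, ⟨n, _, ⟨p, φ, hdec, rfl⟩, rfl⟩, ?_⟩
      refine smoothCondEntropyZero_le (w := 0) ⟨?_, ⟨0, rfl⟩, ?_⟩ fun i => by simp
      · exact cqOp_posSemidef fun i => PosSemidef.zero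
      · rw [cqOp_zero, zero_sub, traceNorm_neg, traceNorm_reduceRA_cqExtension hdec]
        exact h1
    -- Now `√ε < 1/2`, so `ε < 2√ε`; the strict gap provides an actual protocol with `1 - F² < 2√ε`.
    · have hlt : 1 - 2 * Real.sqrt ε < dilutionFidelity ρ M := by nlinarith
      have hne : {f : ℝ | ∃ Λ : BipMat M M → BipMat dA dB, IsLOCC dA dB M M Λ ∧
          f = fidelity (Λ (maxEntangled M)) ρ ^ 2}.Nonempty := by
        by_contra hempty
        rw [Set.not_nonempty_iff_eq_empty] at hempty
        rw [dilutionFidelity, hempty, Real.sSup_empty] at hlt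
        linarith
      obtain ⟨_, ⟨Λ, hΛ, rfl⟩, hΛF⟩ := exists_lt_of_lt_csSup hne hlt
      obtain ⟨n, p, φ, w, hdec, hwp, hwr, hwn⟩ := hΛ.exists_decomposition_near hρ hM
      refine ⟨_, ⟨n, _, ⟨p, φ, hdec, rfl⟩, rfl⟩, ?_⟩
      exact smoothCondEntropyZero_le ⟨cqOp_posSemidef hwp, ⟨w, rfl⟩, by linarith⟩ hwr

/-- Every value of the smoothed entropy at radius `ε / 2` bounds the cost. -/
lemma oneShotCost_le_of_mem_smoothEntropyValues {ρ : BipMat dA dB} (hρ : IsState ρ) {ε : ℝ}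
    (hε : 0 ≤ ε) (hε2 : ε < 2) {x : EReal} (hx : x ∈ smoothEntropyValues ρ (ε / 2)) :
    (oneShotCost ρ ε : EReal) ≤ x := by
  obtain ⟨n, _, ⟨p, φ, hdec, rfl⟩, rfl⟩ := hx
  obtain ⟨M, -, w, hw, hwM, hM⟩ := exists_smoothCondEntropyZero_eq hdec (δ := ε / 2) (by linarith)
  rw [hM]
  have hr := (condEntropyZero_cqOp_le_iff w M).1 hwM.le
  -- `M = 0` would place the zero operator within `ε / 2 < 1` of `ρ_RA`, whose trace norm is 1. This
  -- is where `ε < 2` enters.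
  have hM0 : M ≠ 0 := by
    rintro rfl
    have hw0 : w = 0 := by
      funext i
      exact eq_zero_of_rank_eq_zero (Nat.le_zero.1 (hr i))
    have := hw.2.2
    rw [hw0, cqOp_zero, zero_sub, traceNorm_neg, traceNorm_reduceRA_cqExtension hdec] at this
    linarith
  obtain ⟨M', hM', -, hcost, -, hmin⟩ := exists_oneShotCost_eq hρ hε
  rw [hcost, coe_logb_eq_logTwo hM']
  refine logTwo_mono (Nat.cast_nonneg _) (Nat.cast_le.2 (hmin M hM0 ?_))
  have := le_dilutionFidelity_of_near hρ hM0 hdec hr (by linarith) hw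
  linarith

/-- Members with `p i = 0` give zero blocks and contribute `⊥`; for the others scaling by `p i`
keeps the rank, which is nonzero because the reduced state has trace one. -/
lemma condEntropyZero_cqExtension {n : ℕ} {ρ : BipMat dA dB} {p : Fin n → ℝ}
    {φ : Fin n → Fin dA × Fin dB → ℂ} (hdec : IsDecomposition ρ p φ) :
    condEntropyZero (reduceRA (cqExtension p φ)) = maxLogRank p φ := by
  rw [reduceRA_cqExtension, condEntropyZero_cqOp, maxLogRank]
  refine iSup_congr fun i => ?_
  rw [reduceA_smul]
  rcases (hdec.1 i).eq_or_lt with h | h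
  · simp [← h, logTwo_zero]
  · have hr : (reduceA (ketbra (φ i))).rank ≠ 0 := by
      intro h0
      have := trace_reduceA (ketbra (φ i))
      rw [eq_zero_of_rank_eq_zero h0, trace_ketbra, hdec.2.2.1, trace_zero] at this
      exact zero_ne_one this
    rw [rank_smul_eq (Complex.ofReal_ne_zero.2 h.ne'), coe_logb_eq_logTwo hr]
    simp [h]

/-- The cost is below every value because `ρ_RA` lies in its own ball of radius 0; it is attained by
the decomposition that exact dilution at the optimal `M` yields through compactness. -/
lemma isLeast_condEntropyZero {ρ : BipMat dA dB} (hρ : IsState ρ) :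
    IsLeast {x : EReal | ∃ n : ℕ, ∃ τ ∈ cqExtensions n ρ, x = condEntropyZero (reduceRA τ)}
      (oneShotCost ρ 0 : EReal) := by
  have hlow : ∀ (n : ℕ) (p : Fin n → ℝ) (φ : Fin n → Fin dA × Fin dB → ℂ),
      IsDecomposition ρ p φ →
        (oneShotCost ρ 0 : EReal) ≤ condEntropyZero (reduceRA (cqExtension p φ)) := by
    intro n p φ hdec
    refine (oneShotCost_le_of_mem_smoothEntropyValues hρ le_rfl two_pos
      ⟨n, _, ⟨p, φ, hdec, rfl⟩, rfl⟩).trans (iInf₂_le _ (mem_cqBall_self hdec (by simp)))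
  constructor
  · obtain ⟨M, hM, hF, hcost, -, -⟩ := exists_oneShotCost_eq hρ le_rfl
    obtain ⟨n, p, φ, hdec, hr⟩ := exists_decomposition_rank_le hρ hM (by linarith)
    refine ⟨n, _, ⟨p, φ, hdec, rfl⟩, le_antisymm (hlow n p φ hdec) ?_⟩
    rw [reduceRA_cqExtension, hcost, coe_logb_eq_logTwo hM]
    exact (condEntropyZero_cqOp_le_iff _ M).2 hr
  · rintro _ ⟨n, _, ⟨p, φ, hdec, rfl⟩, rfl⟩
    exact hlow n p φ hdec

end Cost

end OneShotDilution

end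

theorem theorem1 {dA dB : ℕ} (ρ : OneShotDilution.BipMat dA dB)
    (hρ : OneShotDilution.IsState ρ) :
    -- for every error the cost is a minimum, with the two bounds
    (∀ ε : ℝ, 0 ≤ ε →
      IsLeast {R : ℝ | OneShotDilution.IsAchievableRate ρ ε R}
        (OneShotDilution.oneShotCost ρ ε) ∧
      (∃ lo : EReal,
        IsLeast (OneShotDilution.smoothEntropyValues ρ (2 * Real.sqrt ε)) lo ∧
          lo ≤ (OneShotDilution.oneShotCost ρ ε : EReal)) ∧
      (∃ hi : EReal,
        IsLeast (OneShotDilution.smoothEntropyValues ρ (ε / 2)) hi ∧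
          (ε < 2 → (OneShotDilution.oneShotCost ρ ε : EReal) ≤ hi))) ∧
    -- the exact cost
    IsLeast {x : EReal | ∃ n : ℕ, ∃ τ ∈ OneShotDilution.cqExtensions n ρ,
        x = OneShotDilution.condEntropyZero (OneShotDilution.reduceRA τ)}
      (OneShotDilution.oneShotCost ρ 0 : EReal) ∧
    (∀ (n : ℕ) (p : Fin n → ℝ) (φ : Fin n → Fin dA × Fin dB → ℂ),
      OneShotDilution.IsDecomposition ρ p φ →
        OneShotDilution.condEntropyZero
            (OneShotDilution.reduceRA (OneShotDilution.cqExtension p φ)) =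
          OneShotDilution.maxLogRank p φ) ∧
    IsLeast {x : EReal | ∃ (n : ℕ) (p : Fin n → ℝ) (φ : Fin n → Fin dA × Fin dB → ℂ),
        OneShotDilution.IsDecomposition ρ p φ ∧ x = OneShotDilution.maxLogRank p φ}
      (OneShotDilution.oneShotCost ρ 0 : EReal) := by
  open OneShotDilution in
  refine ⟨fun ε hε => ?_, isLeast_condEntropyZero hρ, fun n p φ h => condEntropyZero_cqExtension h,
    ?_⟩
  · obtain ⟨M, hM, hF, hcost, hleast, -⟩ := exists_oneShotCost_eq hρ hε
    refine ⟨hleast, ?_, ?_⟩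
    · obtain ⟨lo, hlo⟩ := exists_isLeast_smoothEntropyValues hρ
        (mul_nonneg zero_le_two (Real.sqrt_nonneg ε))
      obtain ⟨x, hx, hxM⟩ := exists_smoothEntropyValue_le hρ hε hM hF
      refine ⟨lo, hlo, (hlo.2 hx).trans ?_⟩
      rwa [hcost, coe_logb_eq_logTwo hM]
    · obtain ⟨hi, hhi⟩ := exists_isLeast_smoothEntropyValues hρ (div_nonneg hε zero_le_two)
      exact ⟨hi, hhi, fun h => oneShotCost_le_of_mem_smoothEntropyValues hρ hε h hhi.1⟩
  · convert isLeast_condEntropyZero hρ using 1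
    ext x
    constructor
    · rintro ⟨n, p, φ, hdec, rfl⟩
      exact ⟨n, _, ⟨p, φ, hdec, rfl⟩, (condEntropyZero_cqExtension hdec).symm⟩
    · rintro ⟨n, _, ⟨p, φ, hdec, rfl⟩, rfl⟩
      exact ⟨n, p, φ, hdec, condEntropyZero_cqExtension hdec⟩
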